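/- Let $a,b\in\mathbb R$, let $I\subseteq\mathbb R$ be open and let $\Delta=\Delta(r)$ be an arbitrary positive differentiable function on $I$ (for the Kerr--Sen black hole $\Delta=r^2-2(M-b)r+a^2$). In coordinates $(t,r,\theta,\varphi)$ put $$\rho^2=r^2+a^2\cos^2\theta,\qquad \rho_b^2=\rho^2+2br,\qquad \Phi=2\ln(\rho/\rho_b),$$ and work on the region $U_{a,b}$ given by $r\in I$, $0<\theta<\pi$, $\rho^2>0$, $\rho_b^2>0$. The string-frame Kerr--Sen metric and 3-form field are $$\mathbf g=e^{\Phi}\Bigl\{-\tfrac{\Delta}{\rho_b^2}(dt-a\sin^2\theta\,d\varphi)^2+\tfrac{\sin^2\theta}{\rho_b^2}\bigl[a\,dt-(r^2+2br+a^2)d\varphi\bigr]^2+\tfrac{\rho_b^2}{\Delta}dr^2+\rho_b^2d\theta^2\Bigr\},$$ $$\mathbf H=-\tfrac{2ba}{\rho_b^4}\,dt\wedge d\varphi\wedge\bigl[(r^2-a^2\cos^2\theta)\sin^2\theta\,dr-r\Delta\sin2\theta\,d\theta\bigr].$$ Let $$e^0=\tfrac{\rho\sqrt\Delta}{\rho_b^2}(dt-a\sin^2\theta\,d\varphi),\quad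 e^1=\tfrac{\rho}{\sqrt\Delta}dr,\quad e^2=\tfrac{\rho\sin\theta}{\rho_b^2}\bigl[a\,dt-(r^2+2br+a^2)d\varphi\bigr],\quad e^3=\rho\,d\theta,$$ write $e^{ij}=e^i\wedge e^j$, $e^{ijk}=e^i\wedge e^j\wedge e^k$, and $$T_0^\pm=-\tfrac{2a\sin\theta}{\rho}\Bigl(-\tfrac{r+b}{\rho_b^2}\pm\tfrac r{\rho^2}\Bigr),\qquad T_1^\pm=-\tfrac{2a\cos\theta\sqrt\Delta}{\rho}\Bigl(-\tfrac1{\rho_b^2}\pm\tfrac1{\rho^2}\Bigr).$$ For a 3-form $T$ let $\nabla^T$ be the connection $\nabla^T_XY=\nabla_XY+\frac12T(X,Y,\cdot)^\sharp$ ($\nabla$ the Levi-Civita connection of $\mathbf g$), extended to differential forms, and let $d^T\omega=e^a\wedge\nabla^T_{X_a}\omega$, $\delta^T\omega=-X^a\lrcorner\nabla^T_{X_a}\omega$ for an orthonormal frame $X_a$ with dual coframe $e^a$; $\delta=\delta^{0}$. A 2-form $h$ is a generalized closed conformal Killing--Yano (GCCKY) 2-form for the torsion $T$ if $d^Th=0$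 and, for every vector $X$, $\nabla^T_Xh-\frac13X\lrcorner d^Th+\frac13X^\flat\wedge\delta^Th=0$. Then: (0) On $U_{a,b}$, $\mathbf g$ is a differentiable pseudo-Riemannian metric, $\mathbf g=-e^0e^0+e^1e^1+e^2e^2+e^3e^3$ and $\mathbf H=T_0^+e^{012}+T_1^+e^{023}$. (1) For the torsion $T_+=\mathbf H$, the form $h_+=r\,e^{01}+a\cos\theta\,e^{23}$ is a GCCKY 2-form on $U_{a,b}$, and for every vector $X$ $$\nabla^{T_+}_Xh_+=X^\flat\wedge\xi_+,\qquad \xi_+=-\tfrac13\delta^{T_+}h_+=-\tfrac{\sqrt\Delta}{\rho}e^0+\tfrac{a\sin\theta}{\rho}e^2,\qquad \xi_+^\sharp=e^{-\Phi}\partial_t .$$ (2) For the torsion $T_-=T_0^-e^{012}+T_1^-e^{023}$, the form $h_-=r\,e^{01}-a\cos\theta\,e^{23}$ is a GCCKY 2-form on $U_{a,b}$, and for every vector $X$ $$\nabla^{T_-}_Xh_-=X^\flat\wedge\xi_-,\qquad \xi_-=-\tfrac13\delta^{T_-}h_-=-\tfrac{\sqrt\Delta}{\rho}e^0-\tfrac{a\sin\theta}{\rho}e^2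 .$$ If $a\neq0$, then $T_-\neq T_+$ at every point of $U_{a,b}$. (3) For $b=0$ the torsion $T=T_-|_{b=0}$ is differentiable on $U_{a,0}$ and equals $$T=\tfrac{4a}{\rho^3}\bigl(r\sin\theta\,e^{012}+\cos\theta\sqrt\Delta\,e^{023}\bigr).$$ It is nonzero at every point of $U_{a,0}$ if $a\ne0$, it satisfies $\delta T=0$ on $U_{a,0}$, and at every point with $r\neq0$ one has $T=*d\alpha$ with $\alpha=4\arctan(a\cos\theta/r)$, where $*\omega=\omega^\sharp\lrcorner(e^0\wedge e^1\wedge e^2\wedge e^3)$ for 1-forms $\omega$. -/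

import Mathlib

set_option maxSynthPendingDepth 3

noncomputable section

namespace KerrSen

/-! ### Tensor calculus on an open subset of `ℝⁿ`, in coordinates

A metric is a field `g : Coord n → Coord n →L[ℝ] Coord n →L[ℝ] ℝ` of bilinear forms and a
differential `p`-form is a field `Coord n → Coord n [⋀^Fin p]→L[ℝ] ℝ`, as in Mathlib. -/

/-- The coordinate space `ℝⁿ` (the choice of norm plays no role). -/
abbrev Coord (n : ℕ) : Type := Fin n → ℝ

/-- The coordinate vector field `∂_i`. -/
def partialVec {n : ℕ} (i : Fin n) : Coord n := Pi.single i 1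

/-- The coordinate covector field `dx^i`. -/
def dCoord {n : ℕ} (i : Fin n) : Coord n →L[ℝ] ℝ := ContinuousLinearMap.proj i

/-- A covector, seen as an alternating 1-form. -/
def asForm {n : ℕ} (α : Coord n →L[ℝ] ℝ) : Coord n [⋀^Fin 1]→L[ℝ] ℝ :=
  ContinuousAlternatingMap.ofSubsingleton ℝ (Coord n) ℝ (0 : Fin 1) α

/-- The wedge product `α ∧ ω` of a covector `α` and a `p`-form `ω`. -/
def wedge {n p : ℕ} (α : Coord n →L[ℝ] ℝ) (ω : Coord n [⋀^Fin p]→L[ℝ] ℝ) :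
    Coord n [⋀^Fin (p + 1)]→L[ℝ] ℝ :=
  ContinuousAlternatingMap.alternatizeUncurryFin (α.smulRight ω)

theorem wedge_apply {n p : ℕ} (α : Coord n →L[ℝ] ℝ) (ω : Coord n [⋀^Fin p]→L[ℝ] ℝ)
    (v : Fin (p + 1) → Coord n) :
    wedge α ω v = ∑ i : Fin (p + 1), (-1) ^ (i : ℕ) * (α (v i) * ω (i.removeNth v)) := by
  simp [wedge, ContinuousAlternatingMap.alternatizeUncurryFin_apply]

/-- The tensor product `α ⊗ β` of two covectors. -/
def tensor {n : ℕ} (α β : Coord n →L[ℝ] ℝ) : Coord n →L[ℝ] Coord n →L[ℝ] ℝ :=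
  α.smulRight β

/-- The matrix `g_{ij}` of the metric. -/
def gramMatrix {n : ℕ} (g : Coord n → Coord n →L[ℝ] Coord n →L[ℝ] ℝ) (x : Coord n) :
    Matrix (Fin n) (Fin n) ℝ :=
  Matrix.of fun i j => g x (partialVec i) (partialVec j)

/-- `g` is a (differentiable) pseudo-Riemannian metric on `U`. -/
def IsMetricOn {n : ℕ} (U : Set (Coord n)) (g : Coord n → Coord n →L[ℝ] Coord n →L[ℝ] ℝ) :
    Prop :=
  DifferentiableOn ℝ g U ∧ (∀ x ∈ U, ∀ v w, g x v w = g x w v) ∧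
    ∀ x ∈ U, ∀ v, (∀ w, g x v w = 0) → v = 0

/-- Raising an index: `α ↦ α^♯ = g^{ij} α_j ∂_i`. -/
def sharp {n : ℕ} (g : Coord n → Coord n →L[ℝ] Coord n →L[ℝ] ℝ) (x : Coord n) :
    (Coord n →L[ℝ] ℝ) →L[ℝ] Coord n :=
  ∑ i, ∑ j, (gramMatrix g x)⁻¹ i j •
    (ContinuousLinearMap.apply ℝ ℝ (partialVec j : Coord n)).smulRight (partialVec i)

theorem sharp_apply {n : ℕ} (g : Coord n → Coord n →L[ℝ] Coord n →L[ℝ] ℝ) (x : Coord n)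
    (α : Coord n →L[ℝ] ℝ) :
    sharp g x α = ∑ i, ∑ j, ((gramMatrix g x)⁻¹ i j * α (partialVec j)) • partialVec i := by
  simp [sharp, mul_smul]

/-- The Christoffel symbols of the first kind:
`christoffelLower g x X Y Z = ½ ((∂_X g)(Y, Z) + (∂_Y g)(X, Z) - (∂_Z g)(X, Y))`. -/
def christoffelLower {n : ℕ} (g : Coord n → Coord n →L[ℝ] Coord n →L[ℝ] ℝ) (x : Coord n) :
    Coord n →L[ℝ] Coord n →L[ℝ] Coord n →L[ℝ] ℝ :=
  let B : Coord n →L[ℝ] Coord n →L[ℝ] Coord n →L[ℝ] ℝ := fderiv ℝ g x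
  let C : Coord n →L[ℝ] Coord n →L[ℝ] Coord n →L[ℝ] ℝ :=
    ((ContinuousLinearMap.flipₗᵢ ℝ (Coord n) (Coord n) ℝ).toContinuousLinearEquiv :
      (Coord n →L[ℝ] Coord n →L[ℝ] ℝ) →L[ℝ] Coord n →L[ℝ] Coord n →L[ℝ] ℝ) ∘L B.flip
  (1 / 2 : ℝ) • (B + B.flip - C)

theorem christoffelLower_apply {n : ℕ} (g : Coord n → Coord n →L[ℝ] Coord n →L[ℝ] ℝ)
    (x X Y Z : Coord n) :
    christoffelLower g x X Y Z =
      1 / 2 * (fderiv ℝ g x X Y Z + fderiv ℝ g x Y X Z - fderiv ℝ g x Z X Y) := by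
  simp [christoffelLower]

/-- A connection is given by its coefficient field `A`, with
`∇_X Y = ∂_X Y + A x X Y`.  This is the Levi-Civita connection of `g`. -/
def leviCivita {n : ℕ} (g : Coord n → Coord n →L[ℝ] Coord n →L[ℝ] ℝ) (x : Coord n) :
    Coord n →L[ℝ] Coord n →L[ℝ] Coord n :=
  ContinuousLinearMap.compL ℝ (Coord n) (Coord n →L[ℝ] ℝ) (Coord n) (sharp g x) ∘L
    christoffelLower g x

theorem leviCivita_apply {n : ℕ} (g : Coord n → Coord n →L[ℝ] Coord n →L[ℝ] ℝ)
    (x X Y : Coord n) :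
    leviCivita g x X Y = sharp g x (christoffelLower g x X Y) := rfl

/-- A 3-form `T` as the trilinear map `X, Y, Z ↦ T(X, Y, Z)`. -/
def trilinear {n : ℕ} (T : Coord n [⋀^Fin 3]→L[ℝ] ℝ) :
    Coord n →L[ℝ] Coord n →L[ℝ] Coord n →L[ℝ] ℝ :=
  let e : (Coord n →L[ℝ] ℝ) ≃ₗᵢ[ℝ] (Coord n [⋀^Fin 1]→L[ℝ] ℝ) :=
    ContinuousAlternatingMap.ofSubsingletonLIE (0 : Fin 1)
  ContinuousLinearMap.compL ℝ (Coord n) (Coord n [⋀^Fin 1]→L[ℝ] ℝ) (Coord n →L[ℝ] ℝ)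
      (e.symm.toContinuousLinearEquiv : (Coord n [⋀^Fin 1]→L[ℝ] ℝ) →L[ℝ] Coord n →L[ℝ] ℝ)
    ∘L ContinuousAlternatingMap.curryLeftLI.toContinuousLinearMap ∘L T.curryLeft

theorem trilinear_apply {n : ℕ} (T : Coord n [⋀^Fin 3]→L[ℝ] ℝ) (X Y Z : Coord n) :
    trilinear T X Y Z = T ![X, Y, Z] := by
  change T (Matrix.vecCons X (Matrix.vecCons Y fun _ => Z)) = _
  congr 1
  ext i : 1
  fin_cases i <;> rfl

/-- The metric connection with totally antisymmetric torsion `T`: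
`∇^T_X Y = ∇_X Y + ½ T(X, Y, ·)^♯`. -/
def torsionConn {n : ℕ} (g : Coord n → Coord n →L[ℝ] Coord n →L[ℝ] ℝ)
    (T : Coord n → Coord n [⋀^Fin 3]→L[ℝ] ℝ) (x : Coord n) :
    Coord n →L[ℝ] Coord n →L[ℝ] Coord n :=
  leviCivita g x + (1 / 2 : ℝ) •
    (ContinuousLinearMap.compL ℝ (Coord n) (Coord n →L[ℝ] ℝ) (Coord n) (sharp g x) ∘L
      trilinear (T x))

theorem torsionConn_apply {n : ℕ} (g : Coord n → Coord n →L[ℝ] Coord n →L[ℝ] ℝ)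
    (T : Coord n → Coord n [⋀^Fin 3]→L[ℝ] ℝ) (x X Y : Coord n) :
    torsionConn g T x X Y =
      leviCivita g x X Y + (1 / 2 : ℝ) • sharp g x (trilinear (T x) X Y) := rfl

/-- The covariant derivative `X ↦ ∇_X ω` of a `p`-form with respect to the connection `A`. -/
def covDeriv {n p : ℕ} (A : Coord n → Coord n →L[ℝ] Coord n →L[ℝ] Coord n)
    (ω : Coord n → Coord n [⋀^Fin p]→L[ℝ] ℝ) (x : Coord n) :
    Coord n →L[ℝ] Coord n [⋀^Fin p]→L[ℝ] ℝ :=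
  fderiv ℝ ω x -
    (ω x).fderivCompContinuousLinearMap (ContinuousLinearMap.id ℝ (Coord n)) ∘L A x

theorem covDeriv_apply {n p : ℕ} (A : Coord n → Coord n →L[ℝ] Coord n →L[ℝ] Coord n)
    (ω : Coord n → Coord n [⋀^Fin p]→L[ℝ] ℝ) (x X : Coord n) (v : Fin p → Coord n) :
    covDeriv A ω x X v =
      fderiv ℝ ω x X v - ∑ i, ω x (Function.update v i (A x X (v i))) := by
  simp only [covDeriv, sub_apply, ContinuousLinearMap.comp_apply,
    ContinuousAlternatingMap.sub_apply,
    ContinuousAlternatingMap.fderivCompContinuousLinearMap_apply]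
  congr 1
  refine Finset.sum_congr rfl fun i _ => ?_
  congr 1
  ext j : 1
  by_cases h : j = i
  · subst h; simp
  · simp [h]

/-- `d^A ω = e^a ∧ ∇_{X_a} ω`. -/
def extCov {n p : ℕ} (A : Coord n → Coord n →L[ℝ] Coord n →L[ℝ] Coord n)
    (ω : Coord n → Coord n [⋀^Fin p]→L[ℝ] ℝ) (x : Coord n) :
    Coord n [⋀^Fin (p + 1)]→L[ℝ] ℝ :=
  ContinuousAlternatingMap.alternatizeUncurryFin (covDeriv A ω x)

theorem extCov_eq_sum_wedge {n p : ℕ} (A : Coord n → Coord n →L[ℝ] Coord n →L[ℝ] Coord n)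
    (ω : Coord n → Coord n [⋀^Fin p]→L[ℝ] ℝ) (x : Coord n) :
    extCov A ω x = ∑ i, wedge (dCoord i) (covDeriv A ω x (partialVec i)) := by
  have h : covDeriv A ω x =
      ∑ i, (dCoord i).smulRight (covDeriv A ω x (partialVec i)) := by
    ext1 X
    have hX : X = ∑ i, X i • (partialVec i : Coord n) := by
      simpa [partialVec] using (pi_eq_sum_univ' X)
    conv_lhs => rw [hX]
    simp [dCoord]
  unfold extCov wedge
  simp only [← ContinuousAlternatingMap.alternatizeUncurryFinCLM_apply]
  rw [← map_sum, ← h]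

/-- `δ^A ω = - X^a ⌟ ∇_{X_a} ω = - g^{ij} ∂_i ⌟ ∇_j ω`. -/
def codiff {n p : ℕ} (g : Coord n → Coord n →L[ℝ] Coord n →L[ℝ] ℝ)
    (A : Coord n → Coord n →L[ℝ] Coord n →L[ℝ] Coord n)
    (ω : Coord n → Coord n [⋀^Fin (p + 1)]→L[ℝ] ℝ) (x : Coord n) :
    Coord n [⋀^Fin p]→L[ℝ] ℝ :=
  -∑ i, ∑ j, (gramMatrix g x)⁻¹ i j •
    (covDeriv A ω x (partialVec j)).curryLeft (partialVec i)

/-- The form `k`, of degree `q = p + 1 ≥ 1`, is a generalized conformal Killing-Yano form on `U`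
for the metric `g` and the torsion 3-form `T`:
`∇^T_X k - 1/(q+1) X ⌟ d^T k + 1/(n-q+1) X^♭ ∧ δ^T k = 0` for all `X`. -/
def IsGCKY {n p : ℕ} (U : Set (Coord n)) (g : Coord n → Coord n →L[ℝ] Coord n →L[ℝ] ℝ)
    (T : Coord n → Coord n [⋀^Fin 3]→L[ℝ] ℝ)
    (k : Coord n → Coord n [⋀^Fin (p + 1)]→L[ℝ] ℝ) : Prop :=
  DifferentiableOn ℝ k U ∧ ∀ x ∈ U, ∀ X : Coord n,
    covDeriv (torsionConn g T) k x X
      - (1 / ((p : ℝ) + 2)) • (extCov (torsionConn g T) k x).curryLeft X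
      + (1 / ((n : ℝ) - p)) • wedge (g x X) (codiff g (torsionConn g T) k x) = 0

/-- A generalized closed conformal Killing-Yano (GCCKY) form: a GCKY form `h` with `d^T h = 0`. -/
def IsGCCKY {n p : ℕ} (U : Set (Coord n)) (g : Coord n → Coord n →L[ℝ] Coord n →L[ℝ] ℝ)
    (T : Coord n → Coord n [⋀^Fin 3]→L[ℝ] ℝ)
    (h : Coord n → Coord n [⋀^Fin (p + 1)]→L[ℝ] ℝ) : Prop :=
  IsGCKY U g T h ∧ ∀ x ∈ U, extCov (torsionConn g T) h x = 0

/-- The Hodge dual `*α = α^♯ ⌟ vol` of a covector, for the volume form `vol`. -/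
def hodgeStarOne {n : ℕ} (g : Coord (n + 1) → Coord (n + 1) →L[ℝ] Coord (n + 1) →L[ℝ] ℝ)
    (vol : Coord (n + 1) → Coord (n + 1) [⋀^Fin (n + 1)]→L[ℝ] ℝ) (x : Coord (n + 1))
    (α : Coord (n + 1) →L[ℝ] ℝ) : Coord (n + 1) [⋀^Fin n]→L[ℝ] ℝ :=
  (vol x).curryLeft (sharp g x α)

/-! ### The string-frame Kerr-Sen geometry

Boyer-Lindquist coordinates `(t, r, θ, φ) = (x 0, x 1, x 2, x 3)`. -/

/-- `ρ² = r² + a² cos² θ`. -/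
def rhoSq (a : ℝ) (x : Coord 4) : ℝ := x 1 ^ 2 + a ^ 2 * Real.cos (x 2) ^ 2

/-- `ρ_b² = ρ² + 2 b r`. -/
def rhobSq (a b : ℝ) (x : Coord 4) : ℝ := rhoSq a x + 2 * b * x 1

/-- `ρ`. -/
def rho (a : ℝ) (x : Coord 4) : ℝ := √(rhoSq a x)

/-- The dilaton `Φ = 2 ln (ρ / ρ_b)`. -/
def dilaton (a b : ℝ) (x : Coord 4) : ℝ := 2 * Real.log (rho a x / √(rhobSq a b x))

/-- The coordinate region `r ∈ I`, `0 < θ < π`, `ρ² > 0`, `ρ_b² > 0`. -/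
def region (a b : ℝ) (I : Set ℝ) : Set (Coord 4) :=
  {x | x 1 ∈ I ∧ 0 < x 2 ∧ x 2 < Real.pi ∧ 0 < rhoSq a x ∧ 0 < rhobSq a b x}

/-- `dt - a sin² θ dφ`. -/
def formT (a : ℝ) (x : Coord 4) : Coord 4 →L[ℝ] ℝ :=
  dCoord 0 - (a * Real.sin (x 2) ^ 2) • dCoord 3

/-- `a dt - (r² + 2 b r + a²) dφ`. -/
def formPhi (a b : ℝ) (x : Coord 4) : Coord 4 →L[ℝ] ℝ :=
  a • dCoord 0 - (x 1 ^ 2 + 2 * b * x 1 + a ^ 2) • dCoord 3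

/-- The string-frame Kerr-Sen metric, with an arbitrary function `Δ(r)`. -/
def metric (a b : ℝ) (Δ : ℝ → ℝ) (x : Coord 4) : Coord 4 →L[ℝ] Coord 4 →L[ℝ] ℝ :=
  Real.exp (dilaton a b x) •
    (-(Δ (x 1) / rhobSq a b x) • tensor (formT a x) (formT a x)
      + (Real.sin (x 2) ^ 2 / rhobSq a b x) • tensor (formPhi a b x) (formPhi a b x)
      + (rhobSq a b x / Δ (x 1)) • tensor (dCoord 1) (dCoord 1)
      + rhobSq a b x • tensor (dCoord 2) (dCoord 2))

/-- The 3-form field strength `H` of the Kerr-Sen solution. -/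
def fieldH (a b : ℝ) (Δ : ℝ → ℝ) (x : Coord 4) : Coord 4 [⋀^Fin 3]→L[ℝ] ℝ :=
  -(2 * b * a / rhobSq a b x ^ 2) • wedge (dCoord 0) (wedge (dCoord 3) (asForm
    (((x 1 ^ 2 - a ^ 2 * Real.cos (x 2) ^ 2) * Real.sin (x 2) ^ 2) • dCoord 1
      - (x 1 * Δ (x 1) * Real.sin (2 * x 2)) • dCoord 2)))

/-- The basis of 1-forms `e⁰, e¹, e², e³`. -/
def coframe (a b : ℝ) (Δ : ℝ → ℝ) (x : Coord 4) : Fin 4 → (Coord 4 →L[ℝ] ℝ) :=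
  ![(rho a x * √(Δ (x 1)) / rhobSq a b x) • formT a x,
    (rho a x / √(Δ (x 1))) • dCoord 1,
    (rho a x * Real.sin (x 2) / rhobSq a b x) • formPhi a b x,
    rho a x • dCoord 2]

/-- `e^{ij} = e^i ∧ e^j`. -/
def e2 (a b : ℝ) (Δ : ℝ → ℝ) (i j : Fin 4) (x : Coord 4) : Coord 4 [⋀^Fin 2]→L[ℝ] ℝ :=
  wedge (coframe a b Δ x i) (asForm (coframe a b Δ x j))

/-- `e^{ijk} = e^i ∧ e^j ∧ e^k`. -/
def e3 (a b : ℝ) (Δ : ℝ → ℝ) (i j k : Fin 4) (x : Coord 4) : Coord 4 [⋀^Fin 3]→L[ℝ] ℝ :=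
  wedge (coframe a b Δ x i) (e2 a b Δ j k x)

/-- The volume form `e^{0123}`. -/
def volForm (a b : ℝ) (Δ : ℝ → ℝ) (x : Coord 4) : Coord 4 [⋀^Fin 4]→L[ℝ] ℝ :=
  wedge (coframe a b Δ x 0) (e3 a b Δ 1 2 3 x)

/-- `T_0^±`, where `s = ±1` is the sign. -/
def T0 (s a b : ℝ) (x : Coord 4) : ℝ :=
  -(2 * a * Real.sin (x 2) / rho a x) * (-((x 1 + b) / rhobSq a b x) + s * (x 1 / rhoSq a x))

/-- `T_1^±`, where `s = ±1` is the sign. -/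
def T1 (s a b : ℝ) (Δ : ℝ → ℝ) (x : Coord 4) : ℝ :=
  -(2 * a * Real.cos (x 2) * √(Δ (x 1)) / rho a x) * (-(1 / rhobSq a b x) + s * (1 / rhoSq a x))

/-- The torsion `T_- = T_0^- e^{012} + T_1^- e^{023}`. -/
def torsionMinus (a b : ℝ) (Δ : ℝ → ℝ) (x : Coord 4) : Coord 4 [⋀^Fin 3]→L[ℝ] ℝ :=
  T0 (-1) a b x • e3 a b Δ 0 1 2 x + T1 (-1) a b Δ x • e3 a b Δ 0 2 3 x

/-- `h_± = r e⁰ ∧ e¹ ± a cos θ e² ∧ e³`, where `s = ±1` is the sign. -/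
def hForm (s a b : ℝ) (Δ : ℝ → ℝ) (x : Coord 4) : Coord 4 [⋀^Fin 2]→L[ℝ] ℝ :=
  x 1 • e2 a b Δ 0 1 x + (s * (a * Real.cos (x 2))) • e2 a b Δ 2 3 x

/-- `ξ_± = - (√Δ / ρ) e⁰ ± (a sin θ / ρ) e²`, where `s = ±1` is the sign. -/
def xi (s a b : ℝ) (Δ : ℝ → ℝ) (x : Coord 4) : Coord 4 →L[ℝ] ℝ :=
  -(√(Δ (x 1)) / rho a x) • coframe a b Δ x 0
    + (s * (a * Real.sin (x 2) / rho a x)) • coframe a b Δ x 2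

end KerrSen

end

namespace KerrSen

open Matrix

/-! Everything is computed in the orthonormal coframe by Cartan's method. For a metric connection
with totally antisymmetric torsion, the covariant derivatives of the coframe depend only on the
exterior derivatives `dE^a` and on the torsion (`IsOrthoFrame.covDeriv_coframe`), so the whole
geometry enters through eight structure functions of the coframe.

For `p E^{01} + q E^{23}` the connection coefficients that rotate the 01-plane or the 23-plane into
itself drop out. The rest of the equation `∇_X h = X^♭ ∧ (-k E^0 + σ E^2)` consists of two 2×2
linear systems, one in `(c210 + t₀) / 2` and `c030`, the other in `(c032 - t₁) / 2` and `c212`, both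
of determinant `±(p² + q²)` (`StructureConstants.Holds.covDeriv_two_form`). With `p = r` and `q = ±a
cos θ` one has `p² + q² = ρ²`. The torsion coefficients `T_0^±`, `T_1^±` cancel the `b`-dependence
of `c210` and `c032` and leave the solution of these systems (`Regular.hForm_covDeriv`). The
derivative of `Δ` occurs only in `c010`, which has dropped out; hence `Δ` is arbitrary.

An equation `∇_X h = X^♭ ∧ ξ` contains the rest of the GCCKY property: antisymmetrizing gives `d^T h
= 0` because `g` is symmetric, and taking the trace gives `δ^T h = -(n - 1) ξ`.

For `b = 0`, `δT = 0` amounts to closedness of a 1-form in `E^1`, `E^3`, which is checked directly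
and thus also where `r = 0`. Away from `r = 0` that 1-form is exact, up to sign the differential of
`4 arctan (a cos θ / r)`. -/

/-- `E` is a coframe with dual frame `F` in which the bilinear form `B` is `∑ η_a E^a ⊗ E^a`. -/
structure IsOrthoFrame {n : ℕ} (B : Coord n →L[ℝ] Coord n →L[ℝ] ℝ) (η : Fin n → ℝ)
    (E : Fin n → Coord n →L[ℝ] ℝ) (F : Fin n → Coord n) : Prop where
  sq : ∀ a, η a * η a = 1
  dual : ∀ a b, E a (F b) = if a = b then 1 else 0
  eq_sum : B = ∑ a, η a • tensor (E a) (E a)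

theorem tensor_apply {n : ℕ} (α β : Coord n →L[ℝ] ℝ) (v w : Coord n) :
    tensor α β v w = α v * β w := by
  simp [tensor]

theorem eq_sum_partialVec {n : ℕ} (v : Coord n) : v = ∑ i, v i • (partialVec i : Coord n) := by
  simpa [partialVec] using (pi_eq_sum_univ' v)

/-! ### Metrics, traces and connections in an orthonormal frame -/

section Frame

variable {n : ℕ} {η : Fin n → ℝ} {E : Fin n → Coord n →L[ℝ] ℝ} {F : Fin n → Coord n}
  {g : Coord n → Coord n →L[ℝ] Coord n →L[ℝ] ℝ} {x : Coord n}

theorem IsOrthoFrame.apply (h : IsOrthoFrame (g x) η E F) (v w : Coord n) :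
    g x v w = ∑ a, η a * (E a v * E a w) := by
  simp [h.eq_sum, tensor_apply]

/-- Duality is the product in the opposite order, and one-sided inverses of square matrices are
two-sided. This order expresses completeness of the frame. -/
theorem IsOrthoFrame.mul_eq_one (h : IsOrthoFrame (g x) η E F) :
    (Matrix.of fun i a => F a i) * (Matrix.of fun a i => E a (partialVec i)) = 1 := by
  rw [mul_eq_one_comm]
  ext a b
  rw [Matrix.mul_apply, Matrix.one_apply, ← h.dual a b]
  conv_rhs => rw [eq_sum_partialVec (F b)]
  simp [mul_comm]

theorem IsOrthoFrame.eq_sum_frame (h : IsOrthoFrame (g x) η E F) (v : Coord n) :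
    v = ∑ a, E a v • F a := by
  have h1 := congrArg (fun M => M *ᵥ v) h.mul_eq_one
  simp only [← Matrix.mulVec_mulVec, Matrix.one_mulVec] at h1
  conv_lhs => rw [← h1]
  ext i
  simp only [Matrix.mulVec, dotProduct, Matrix.of_apply, Finset.sum_apply, Pi.smul_apply,
    smul_eq_mul]
  refine Finset.sum_congr rfl fun a _ => ?_
  conv_rhs => rw [eq_sum_partialVec v]
  simp [mul_comm]

/-- With `Q` the matrix of the coframe and `P = Q⁻¹` that of the frame, the Gram matrix is `Qᵀ η Q`,
and `η² = 1` makes `P η Pᵀ` its inverse. -/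
theorem IsOrthoFrame.gramMatrix_inv (h : IsOrthoFrame (g x) η E F) (i j : Fin n) :
    (gramMatrix g x)⁻¹ i j = ∑ a, η a * (F a i * F a j) := by
  let P : Matrix (Fin n) (Fin n) ℝ := Matrix.of fun i a => F a i
  let Q : Matrix (Fin n) (Fin n) ℝ := Matrix.of fun a i => E a (partialVec i)
  have hPQ : P * Q = 1 := h.mul_eq_one
  have hQP : Q * P = 1 := mul_eq_one_comm.1 hPQ
  have hG : gramMatrix g x = Qᵀ * diagonal η * Q := by
    ext i j
    rw [Matrix.mul_apply]
    simp only [gramMatrix, Matrix.of_apply, h.apply, Matrix.mul_diagonal,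
      Matrix.transpose_apply, Q]
    exact Finset.sum_congr rfl fun a _ => by ring
  have hη : diagonal η * diagonal η = 1 := by
    simp [h.sq]
  have hinv : (gramMatrix g x)⁻¹ = P * diagonal η * Pᵀ := by
    refine Matrix.inv_eq_right_inv ?_
    calc gramMatrix g x * (P * diagonal η * Pᵀ)
        = Qᵀ * diagonal η * (Q * P) * diagonal η * Pᵀ := by
          rw [hG]; simp only [Matrix.mul_assoc]
      _ = Qᵀ * (diagonal η * diagonal η) * Pᵀ := by
          rw [hQP]; simp only [Matrix.mul_assoc, Matrix.one_mul]
      _ = 1 := by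
          rw [hη, Matrix.mul_one, ← Matrix.transpose_mul, hPQ, Matrix.transpose_one]
  rw [hinv, Matrix.mul_apply]
  simp only [Matrix.mul_diagonal, Matrix.transpose_apply, P, Matrix.of_apply]
  exact Finset.sum_congr rfl fun a _ => by ring

/-- The contraction `g^{ij} β(∂_i, ∂_j)` may be computed in any orthonormal frame. -/
theorem IsOrthoFrame.contract {V : Type*} [AddCommGroup V] [Module ℝ V]
    (h : IsOrthoFrame (g x) η E F) (β : Coord n →ₗ[ℝ] Coord n →ₗ[ℝ] V) :
    ∑ i, ∑ j, (gramMatrix g x)⁻¹ i j • β (partialVec i) (partialVec j) =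
      ∑ a, η a • β (F a) (F a) := by
  have hF : ∀ a, β (F a) (F a) = ∑ i, ∑ j, (F a i * F a j) • β (partialVec i) (partialVec j) := by
    intro a
    conv_lhs => rw [eq_sum_partialVec (F a)]
    simp only [map_sum, map_smul, LinearMap.sum_apply, LinearMap.smul_apply, Finset.smul_sum,
      smul_smul]
    rw [Finset.sum_comm]
    refine Finset.sum_congr rfl fun i _ => Finset.sum_congr rfl fun j _ => ?_
    rw [mul_comm]
  simp only [hF, h.gramMatrix_inv, Finset.sum_smul, Finset.smul_sum, smul_smul]
  rw [Finset.sum_comm' (t' := Finset.univ) (s' := fun _ => Finset.univ) (by simp)]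
  conv_rhs => rw [Finset.sum_comm]
  conv_lhs => rw [Finset.sum_comm]
  refine Finset.sum_congr rfl fun i _ => ?_
  rw [Finset.sum_comm]

theorem IsOrthoFrame.sharp_eq (h : IsOrthoFrame (g x) η E F) (α : Coord n →L[ℝ] ℝ) :
    sharp g x α = ∑ a, (η a * α (F a)) • F a := by
  have := h.contract (LinearMap.mk₂ ℝ (fun v w : Coord n => α w • v)
    (by intros; simp) (fun _ _ _ => smul_comm _ _ _) (by intros; simp [add_smul])
    (by intros; simp [mul_smul]))
  simp only [LinearMap.mk₂_apply, smul_smul] at this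
  rw [sharp_apply, this]

theorem IsOrthoFrame.coframe_sharp (h : IsOrthoFrame (g x) η E F) (α : Coord n →L[ℝ] ℝ)
    (a : Fin n) : E a (sharp g x α) = η a * α (F a) := by
  simp [h.sharp_eq, h.dual]

theorem IsOrthoFrame.sharp_metric (h : IsOrthoFrame (g x) η E F) (v : Coord n) :
    sharp g x (g x v) = v := by
  rw [h.sharp_eq]
  conv_rhs => rw [h.eq_sum_frame v]
  refine Finset.sum_congr rfl fun a _ => ?_
  simp [h.apply, h.dual, ← mul_assoc, h.sq]

theorem IsOrthoFrame.symm (h : IsOrthoFrame (g x) η E F) (v w : Coord n) :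
    g x v w = g x w v := by
  simp only [h.apply, mul_comm]

theorem IsOrthoFrame.nondegenerate (h : IsOrthoFrame (g x) η E F) (v : Coord n)
    (hv : ∀ w, g x v w = 0) : v = 0 := by
  rw [← h.sharp_metric v, show g x v = 0 from ContinuousLinearMap.ext hv, map_zero]

theorem IsOrthoFrame.codiff_eq {p : ℕ} (h : IsOrthoFrame (g x) η E F)
    (A : Coord n → Coord n →L[ℝ] Coord n →L[ℝ] Coord n)
    (ω : Coord n → Coord n [⋀^Fin (p + 1)]→L[ℝ] ℝ) :
    codiff g A ω x = -∑ a, η a • (covDeriv A ω x (F a)).curryLeft (F a) := by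
  have := h.contract (LinearMap.mk₂ ℝ
    (fun v w : Coord n => (covDeriv A ω x w).curryLeft v)
    (by intros; simp) (by intros; simp) (by intros; simp) (by intros; simp))
  simp only [LinearMap.mk₂_apply] at this
  rw [codiff, this]

/-- The covariant derivative of the coframe for the metric connection with torsion `T`, in terms
of the exterior derivatives of the coframe. -/
theorem IsOrthoFrame.covDeriv_coframe {Ef : Coord n → Fin n → Coord n →L[ℝ] ℝ}
    (h : IsOrthoFrame (g x) η (Ef x) F)
    (hg : ∀ᶠ y in nhds x, g y = ∑ a, η a • tensor (Ef y a) (Ef y a))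
    {D : Fin n → Coord n →L[ℝ] Coord n →L[ℝ] ℝ}
    (hD : ∀ a, HasFDerivAt (fun y => Ef y a) (D a) x)
    (T : Coord n → Coord n [⋀^Fin 3]→L[ℝ] ℝ) (X Y : Coord n) (a : Fin n) :
    D a X Y - Ef x a (torsionConn g T x X Y) =
      1 / 2 * (D a X Y - D a Y X) - 1 / 2 * η a *
        ((∑ b, η b * Ef x b Y * (D b X (F a) - D b (F a) X)) +
          (∑ b, η b * Ef x b X * (D b Y (F a) - D b (F a) Y)) + T x ![X, Y, F a]) := by
  have hgd : ∀ X Y Z : Coord n, fderiv ℝ g x X Y Z =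
      ∑ b, η b * (D b X Y * Ef x b Z + Ef x b Y * D b X Z) := by
    intro X Y Z
    have h1 : HasFDerivAt g (fderiv ℝ g x) x := by
      refine DifferentiableAt.hasFDerivAt ?_
      have : DifferentiableAt ℝ (fun y => ∑ a, η a • tensor (Ef y a) (Ef y a)) x := by
        refine DifferentiableAt.fun_sum fun a _ => ?_
        have := (hD a).differentiableAt
        unfold tensor
        fun_prop
      exact this.congr_of_eventuallyEq hg
    have h2 : HasFDerivAt (fun y => g y Y Z)
        (((ContinuousLinearMap.apply ℝ ℝ Z).comp
          (ContinuousLinearMap.apply ℝ (Coord n →L[ℝ] ℝ) Y)).comp (fderiv ℝ g x)) x :=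
      ((ContinuousLinearMap.apply ℝ ℝ Z).comp
          (ContinuousLinearMap.apply ℝ (Coord n →L[ℝ] ℝ) Y)).hasFDerivAt.comp x h1
    have h3 : HasFDerivAt (fun y => ∑ b, η b * (Ef y b Y * Ef y b Z))
        (∑ b, η b • (Ef x b Y • ((ContinuousLinearMap.apply ℝ ℝ Z).comp (D b)) +
          Ef x b Z • ((ContinuousLinearMap.apply ℝ ℝ Y).comp (D b)))) x := by
      refine HasFDerivAt.fun_sum fun b _ => ?_
      exact ((((ContinuousLinearMap.apply ℝ ℝ Y).hasFDerivAt.comp x (hD b))).mul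
        (((ContinuousLinearMap.apply ℝ ℝ Z).hasFDerivAt.comp x (hD b)))).const_mul (η b)
    have h4 : (fun y => g y Y Z) =ᶠ[nhds x] fun y => ∑ b, η b * (Ef y b Y * Ef y b Z) := by
      filter_upwards [hg] with y hy
      simp [hy, tensor_apply]
    have h5 := congrArg (fun L => L X) (h2.unique (h3.congr_of_eventuallyEq h4))
    simp only [ContinuousLinearMap.comp_apply, ContinuousLinearMap.apply_apply,
      _root_.sum_apply, _root_.smul_apply,
      _root_.add_apply, smul_eq_mul] at h5
    rw [h5]
    exact Finset.sum_congr rfl fun b _ => by ring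
  -- Duality and `η_a² = 1` expand a single component into a sum over the frame, so that `D a X Y`
  -- and `D a Y X` can be compared with the sums coming from the Christoffel symbols.
  have hs : ∀ f : Fin n → ℝ, f a = η a * ∑ b, η b * (f b * Ef x b (F a)) := by
    intro f
    simp [h.dual, ← mul_assoc, h.sq]
  rw [torsionConn_apply, leviCivita_apply, map_add, map_smul, h.coframe_sharp, h.coframe_sharp,
    christoffelLower_apply, trilinear_apply, hgd, hgd, hgd, hs fun b => D b X Y,
    hs fun b => D b Y X, smul_eq_mul]
  -- The six terms of the Christoffel symbol regroup: the derivatives in the directions `X` and `Y`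
  -- of `E^b(F_a)`-terms stay as they are, and all others pair up into `dE^b(X, F_a)` and `dE^b(Y,
  -- F_a)`.
  have key : (∑ b, η b * (D b X Y * Ef x b (F a) + Ef x b Y * D b X (F a))) +
      (∑ b, η b * (D b Y X * Ef x b (F a) + Ef x b X * D b Y (F a))) -
      (∑ b, η b * (D b (F a) X * Ef x b Y + Ef x b X * D b (F a) Y)) =
      (∑ b, η b * (D b X Y * Ef x b (F a))) + (∑ b, η b * (D b Y X * Ef x b (F a))) +
      (∑ b, η b * Ef x b Y * (D b X (F a) - D b (F a) X)) +
      (∑ b, η b * Ef x b X * (D b Y (F a) - D b (F a) Y)) := by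
    simp only [← Finset.sum_add_distrib, ← Finset.sum_sub_distrib]
    exact Finset.sum_congr rfl fun b _ => by ring
  rw [key]
  ring

end Frame

/-! ### Product rules for wedge products of covector fields -/

section Wedge

variable {n p : ℕ}

/-- The wedge product as a continuous bilinear map. -/
noncomputable def wedgeCLM : (Coord n →L[ℝ] ℝ) →L[ℝ] (Coord n [⋀^Fin p]→L[ℝ] ℝ) →L[ℝ]
    Coord n [⋀^Fin (p + 1)]→L[ℝ] ℝ :=
  (ContinuousLinearMap.compL ℝ _ _ _
    (ContinuousAlternatingMap.alternatizeUncurryFinCLM ℝ (Coord n) ℝ)) ∘L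
    ContinuousLinearMap.smulRightL ℝ (Coord n) (Coord n [⋀^Fin p]→L[ℝ] ℝ)

theorem wedgeCLM_apply (α : Coord n →L[ℝ] ℝ) (ω : Coord n [⋀^Fin p]→L[ℝ] ℝ) :
    wedgeCLM α ω = wedge α ω := rfl

/-- The identification of covectors with 1-forms as a continuous linear map. -/
noncomputable def asFormCLM : (Coord n →L[ℝ] ℝ) →L[ℝ] Coord n [⋀^Fin 1]→L[ℝ] ℝ :=
  let e : (Coord n →L[ℝ] ℝ) ≃ₗᵢ[ℝ] (Coord n [⋀^Fin 1]→L[ℝ] ℝ) :=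
    ContinuousAlternatingMap.ofSubsingletonLIE (0 : Fin 1)
  e.toContinuousLinearEquiv

theorem asFormCLM_apply (α : Coord n →L[ℝ] ℝ) : asFormCLM α = asForm α := rfl

theorem asForm_apply (α : Coord n →L[ℝ] ℝ) (v : Fin 1 → Coord n) : asForm α v = α (v 0) := rfl

theorem hasFDerivAt_wedge {α : Coord n → Coord n →L[ℝ] ℝ}
    {ω : Coord n → Coord n [⋀^Fin p]→L[ℝ] ℝ} {x : Coord n}
    {α' : Coord n →L[ℝ] Coord n →L[ℝ] ℝ} {ω' : Coord n →L[ℝ] Coord n [⋀^Fin p]→L[ℝ] ℝ}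
    (hα : HasFDerivAt α α' x) (hω : HasFDerivAt ω ω' x) :
    HasFDerivAt (fun y => wedge (α y) (ω y))
      (wedgeCLM.precompR (Coord n) (α x) ω' + wedgeCLM.precompL (Coord n) α' (ω x)) x :=
  wedgeCLM.hasFDerivAt_of_bilinear hα hω

theorem hasFDerivAt_asForm {α : Coord n → Coord n →L[ℝ] ℝ} {x : Coord n}
    {α' : Coord n →L[ℝ] Coord n →L[ℝ] ℝ} (hα : HasFDerivAt α α' x) :
    HasFDerivAt (fun y => asForm (α y)) (asFormCLM ∘L α') x :=
  asFormCLM.hasFDerivAt.comp x hα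

theorem wedge_asForm_apply (α β : Coord n →L[ℝ] ℝ) (v : Fin 2 → Coord n) :
    wedge α (asForm β) v = α (v 0) * β (v 1) - α (v 1) * β (v 0) := by
  rw [wedge_apply, Fin.sum_univ_two]
  change (-1) ^ 0 * (α (v 0) * β (v 1)) + (-1) ^ 1 * (α (v 1) * β (v 0)) = _
  ring

theorem wedge_wedge_asForm_apply (α β γ : Coord n →L[ℝ] ℝ) (v : Fin 3 → Coord n) :
    wedge α (wedge β (asForm γ)) v =
      α (v 0) * (β (v 1) * γ (v 2) - β (v 2) * γ (v 1))
      - α (v 1) * (β (v 0) * γ (v 2) - β (v 2) * γ (v 0))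
      + α (v 2) * (β (v 0) * γ (v 1) - β (v 1) * γ (v 0)) := by
  rw [wedge_apply, Fin.sum_univ_three]
  simp only [wedge_asForm_apply]
  change (-1) ^ 0 * (α (v 0) * (β (v 1) * γ (v 2) - β (v 2) * γ (v 1))) +
    (-1) ^ 1 * (α (v 1) * (β (v 0) * γ (v 2) - β (v 2) * γ (v 0))) +
    (-1) ^ 2 * (α (v 2) * (β (v 0) * γ (v 1) - β (v 1) * γ (v 0))) = _
  ring

theorem wedge_wedge_wedge_asForm_apply (α β γ δ : Coord n →L[ℝ] ℝ) (v : Fin 4 → Coord n) :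
    wedge α (wedge β (wedge γ (asForm δ))) v =
      α (v 0) * wedge β (wedge γ (asForm δ)) ![v 1, v 2, v 3]
      - α (v 1) * wedge β (wedge γ (asForm δ)) ![v 0, v 2, v 3]
      + α (v 2) * wedge β (wedge γ (asForm δ)) ![v 0, v 1, v 3]
      - α (v 3) * wedge β (wedge γ (asForm δ)) ![v 0, v 1, v 2] := by
  rw [wedge_apply, Fin.sum_univ_four]
  have h : ∀ i : Fin 4, i.removeNth v = ![i.removeNth v 0, i.removeNth v 1, i.removeNth v 2] :=
    fun i => by ext j : 1; fin_cases j <;> rfl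
  rw [h 0, h 1, h 2, h 3]
  change (-1) ^ 0 * (α (v 0) * _) + (-1) ^ 1 * (α (v 1) * _) +
    (-1) ^ 2 * (α (v 2) * _) + (-1) ^ 3 * (α (v 3) * _) = _
  simp only [Fin.removeNth_apply]
  change _ * (_ * wedge β (wedge γ (asForm δ)) ![v 1, v 2, v 3]) +
    _ * (_ * wedge β (wedge γ (asForm δ)) ![v 0, v 2, v 3]) +
    _ * (_ * wedge β (wedge γ (asForm δ)) ![v 0, v 1, v 3]) +
    _ * (_ * wedge β (wedge γ (asForm δ)) ![v 0, v 1, v 2]) = _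
  ring

variable {A : Coord n → Coord n →L[ℝ] Coord n →L[ℝ] Coord n} {x : Coord n}
  {α β γ : Coord n → Coord n →L[ℝ] ℝ} {α' β' γ' : Coord n →L[ℝ] Coord n →L[ℝ] ℝ}

theorem covDeriv_smul {f : Coord n → ℝ} {f' : Coord n →L[ℝ] ℝ}
    {ω : Coord n → Coord n [⋀^Fin p]→L[ℝ] ℝ} (hf : HasFDerivAt f f' x)
    (hω : DifferentiableAt ℝ ω x) (X : Coord n) :
    covDeriv A (fun y => f y • ω y) x X = f' X • ω x + f x • covDeriv A ω x X := by
  ext v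
  rw [covDeriv_apply, (hf.fun_smul hω.hasFDerivAt).fderiv]
  simp only [ContinuousAlternatingMap.add_apply, ContinuousAlternatingMap.smul_apply,
    covDeriv_apply, smul_eq_mul, mul_sub, Finset.mul_sum, _root_.add_apply, _root_.smul_apply,
    ContinuousLinearMap.smulRight_apply]
  ring

theorem covDeriv_add {ω ζ : Coord n → Coord n [⋀^Fin p]→L[ℝ] ℝ}
    (hω : DifferentiableAt ℝ ω x) (hζ : DifferentiableAt ℝ ζ x) (X : Coord n) :
    covDeriv A (fun y => ω y + ζ y) x X = covDeriv A ω x X + covDeriv A ζ x X := by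
  ext v
  rw [covDeriv_apply, (hω.hasFDerivAt.fun_add hζ.hasFDerivAt).fderiv]
  simp only [ContinuousAlternatingMap.add_apply,
    covDeriv_apply, Finset.sum_add_distrib, _root_.add_apply]
  ring

theorem covDeriv_wedge_asForm (hα : HasFDerivAt α α' x) (hβ : HasFDerivAt β β' x)
    (X : Coord n) :
    covDeriv A (fun y => wedge (α y) (asForm (β y))) x X =
      wedge (α' X - α x ∘L A x X) (asForm (β x)) +
        wedge (α x) (asForm (β' X - β x ∘L A x X)) := by
  ext v
  rw [covDeriv_apply, (hasFDerivAt_wedge hα (hasFDerivAt_asForm hβ)).fderiv]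
  simp [ContinuousLinearMap.precompR_apply, ContinuousLinearMap.precompL_apply, wedgeCLM_apply,
    asFormCLM_apply, wedge_asForm_apply, Fin.sum_univ_succ]
  ring

theorem covDeriv_wedge_wedge_asForm (hα : HasFDerivAt α α' x) (hβ : HasFDerivAt β β' x)
    (hγ : HasFDerivAt γ γ' x) (X : Coord n) :
    covDeriv A (fun y => wedge (α y) (wedge (β y) (asForm (γ y)))) x X =
      wedge (α' X - α x ∘L A x X) (wedge (β x) (asForm (γ x))) +
        wedge (α x) (wedge (β' X - β x ∘L A x X) (asForm (γ x))) +
        wedge (α x) (wedge (β x) (asForm (γ' X - γ x ∘L A x X))) := by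
  ext v
  rw [covDeriv_apply,
    (hasFDerivAt_wedge hα (hasFDerivAt_wedge hβ (hasFDerivAt_asForm hγ))).fderiv]
  simp [ContinuousLinearMap.precompR_apply, ContinuousLinearMap.precompL_apply, wedgeCLM_apply,
    asFormCLM_apply, wedge_wedge_asForm_apply, Fin.sum_univ_succ]
  ring

end Wedge

/-! ### Consequences of `∇_X ω = X^♭ ∧ ξ` for a 2-form -/

section ClosedConformal

variable {n : ℕ} {η : Fin n → ℝ} {E : Fin n → Coord n →L[ℝ] ℝ} {F : Fin n → Coord n}
  {g : Coord n → Coord n →L[ℝ] Coord n →L[ℝ] ℝ} {x : Coord n}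
  {A : Coord n → Coord n →L[ℝ] Coord n →L[ℝ] Coord n}
  {ω : Coord n → Coord n [⋀^Fin 2]→L[ℝ] ℝ} {ξ : Coord n →L[ℝ] ℝ}

/-- Antisymmetrizing `g(X, Y) ξ(Z)` gives zero, since `g` is symmetric in `X` and `Y`. -/
theorem extCov_eq_zero_of_covDeriv_eq_wedge (hs : ∀ v w, g x v w = g x w v)
    (h : ∀ X, covDeriv A ω x X = wedge (g x X) (asForm ξ)) : extCov A ω x = 0 := by
  ext v
  rw [extCov, ContinuousAlternatingMap.alternatizeUncurryFin_apply, Fin.sum_univ_three]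
  simp only [h, wedge_asForm_apply]
  change (-1) ^ 0 • (g x (v 0) (v 1) * ξ (v 2) - g x (v 0) (v 2) * ξ (v 1)) +
    (-1) ^ 1 • (g x (v 1) (v 0) * ξ (v 2) - g x (v 1) (v 2) * ξ (v 0)) +
    (-1) ^ 2 • (g x (v 2) (v 0) * ξ (v 1) - g x (v 2) (v 1) * ξ (v 0)) = 0
  rw [hs (v 1) (v 0), hs (v 2) (v 0), hs (v 2) (v 1)]
  simp only [zsmul_eq_mul]
  push_cast
  ring

/-- In the trace of `X^♭ ∧ ξ` the first term contributes `n` copies of `ξ`, and the second removes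
the one obtained by expanding `ξ` in the frame. -/
theorem IsOrthoFrame.codiff_eq_of_covDeriv_eq_wedge (hF : IsOrthoFrame (g x) η E F)
    (h : ∀ X, covDeriv A ω x X = wedge (g x X) (asForm ξ)) :
    codiff g A ω x = -((n : ℝ) - 1) • asForm ξ := by
  have h1 : ∀ v, ξ v = ∑ a, η a * ξ (F a) * g x (F a) v := fun v => by
    conv_lhs => rw [hF.eq_sum_frame v]
    simp only [map_sum, map_smul, smul_eq_mul]
    refine Finset.sum_congr rfl fun a _ => ?_
    simp only [hF.apply, hF.dual]
    simp only [ite_mul, one_mul, zero_mul, mul_ite, mul_zero, Finset.sum_ite_eq',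
      Finset.mem_univ, if_true]
    linear_combination (-(E a v) * ξ (F a)) * hF.sq a
  have h2 : ∀ a, η a * g x (F a) (F a) = 1 := fun a => by
    simp [hF.apply, hF.dual, hF.sq]
  ext v
  rw [hF.codiff_eq]
  simp only [h, ContinuousAlternatingMap.neg_apply, ContinuousAlternatingMap.sum_apply,
    ContinuousAlternatingMap.smul_apply, ContinuousAlternatingMap.curryLeft_apply_apply,
    wedge_asForm_apply, smul_eq_mul, asForm_apply]
  change -∑ a, η a * (g x (F a) (F a) * ξ (v 0) - g x (F a) (v 0) * ξ (F a)) = _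
  have h3 : ∀ a, η a * (g x (F a) (F a) * ξ (v 0) - g x (F a) (v 0) * ξ (F a)) =
      ξ (v 0) - η a * ξ (F a) * g x (F a) (v 0) := fun a => by
    linear_combination ξ (v 0) * h2 a
  rw [Finset.sum_congr rfl fun a _ => h3 a, Finset.sum_sub_distrib, ← h1]
  simp
  ring

end ClosedConformal

/-! ### Cartan's structure equations in dimension four -/

/-- Coefficients `c_{abc}` of the structure equations of a coframe in dimension four whose only
nonzero coefficients are those listed. -/
structure StructureConstants where
  (c010 c030 c032 c131 c210 c212 c232 c313 : ℝ)

/-- The structure equations `dE^a = ∑ c_{abc} E^b ∧ E^c`, where `D a` is the derivative of the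
covector field `E^a`. -/
structure StructureConstants.Holds (C : StructureConstants) (E : Fin 4 → Coord 4 →L[ℝ] ℝ)
    (D : Fin 4 → Coord 4 →L[ℝ] Coord 4 →L[ℝ] ℝ) : Prop where
  d0 : ∀ X Y, D 0 X Y - D 0 Y X = C.c010 * (E 1 X * E 0 Y - E 0 X * E 1 Y) +
    C.c030 * (E 3 X * E 0 Y - E 0 X * E 3 Y) + C.c032 * (E 3 X * E 2 Y - E 2 X * E 3 Y)
  d1 : ∀ X Y, D 1 X Y - D 1 Y X = C.c131 * (E 3 X * E 1 Y - E 1 X * E 3 Y)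
  d2 : ∀ X Y, D 2 X Y - D 2 Y X = C.c212 * (E 1 X * E 2 Y - E 2 X * E 1 Y) +
    C.c210 * (E 1 X * E 0 Y - E 0 X * E 1 Y) + C.c232 * (E 3 X * E 2 Y - E 2 X * E 3 Y)
  d3 : ∀ X Y, D 3 X Y - D 3 Y X = C.c313 * (E 1 X * E 3 Y - E 3 X * E 1 Y)

/-- The Lorentzian signature in dimension four. -/
def lorentz : Fin 4 → ℝ := ![-1, 1, 1, 1]

section Dim4

variable {C : StructureConstants} {F : Fin 4 → Coord 4} {Ef : Coord 4 → Fin 4 → Coord 4 →L[ℝ] ℝ}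
  {g : Coord 4 → Coord 4 →L[ℝ] Coord 4 →L[ℝ] ℝ} {x : Coord 4}
  {D : Fin 4 → Coord 4 →L[ℝ] Coord 4 →L[ℝ] ℝ}
  {T : Coord 4 → Coord 4 [⋀^Fin 3]→L[ℝ] ℝ} {t₀ t₁ : ℝ}

/-- The covariant derivatives of the coframe `E` for the torsion `t₀ E^{012} + t₁ E^{023}`. -/
theorem StructureConstants.Holds.covDeriv_coframe (hC : C.Holds (Ef x) D)
    (h : IsOrthoFrame (g x) lorentz (Ef x) F)
    (hg : ∀ᶠ y in nhds x, g y = ∑ a, lorentz a • tensor (Ef y a) (Ef y a))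
    (hD : ∀ a, HasFDerivAt (fun y => Ef y a) (D a) x)
    (hT : T x = t₀ • wedge (Ef x 0) (wedge (Ef x 1) (asForm (Ef x 2))) +
      t₁ • wedge (Ef x 0) (wedge (Ef x 2) (asForm (Ef x 3)))) (X : Coord 4) :
    (D 0 X - Ef x 0 ∘L torsionConn g T x X =
      (-C.c010 * Ef x 0 X + 1 / 2 * (C.c210 - t₀) * Ef x 2 X) • Ef x 1 +
      (1 / 2 * ((C.c210 + t₀) * Ef x 1 X + (C.c032 - t₁) * Ef x 3 X)) • Ef x 2 +
      (-C.c030 * Ef x 0 X + 1 / 2 * (t₁ - C.c032) * Ef x 2 X) • Ef x 3) ∧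
    (D 1 X - Ef x 1 ∘L torsionConn g T x X =
      (-C.c010 * Ef x 0 X + 1 / 2 * (C.c210 - t₀) * Ef x 2 X) • Ef x 0 +
      (C.c212 * Ef x 2 X + 1 / 2 * (C.c210 + t₀) * Ef x 0 X) • Ef x 2 +
      (C.c313 * Ef x 3 X - C.c131 * Ef x 1 X) • Ef x 3) ∧
    (D 2 X - Ef x 2 ∘L torsionConn g T x X =
      (1 / 2 * ((C.c210 + t₀) * Ef x 1 X + (C.c032 - t₁) * Ef x 3 X)) • Ef x 0 -
      (C.c212 * Ef x 2 X + 1 / 2 * (C.c210 + t₀) * Ef x 0 X) • Ef x 1 +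
      (-C.c232 * Ef x 2 X + 1 / 2 * (C.c032 + t₁) * Ef x 0 X) • Ef x 3) ∧
    (D 3 X - Ef x 3 ∘L torsionConn g T x X =
      (-C.c030 * Ef x 0 X + 1 / 2 * (t₁ - C.c032) * Ef x 2 X) • Ef x 0 -
      (C.c313 * Ef x 3 X - C.c131 * Ef x 1 X) • Ef x 1 -
      (-C.c232 * Ef x 2 X + 1 / 2 * (C.c032 + t₁) * Ef x 0 X) • Ef x 2) := by
  -- What follows evaluates the general coframe formula at each frame vector. The factors of `1 / 2`
  -- account for the component of `∇_X E^a` occurring on both sides.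
  have hη : lorentz 0 = -1 ∧ lorentz 1 = 1 ∧ lorentz 2 = 1 ∧ lorentz 3 = 1 :=
    ⟨rfl, rfl, rfl, rfl⟩
  obtain ⟨h0, h1, h2, h3⟩ := hη
  have key := fun Y => h.covDeriv_coframe hg hD T X Y
  simp only [Fin.sum_univ_four, hC.d0, hC.d1, hC.d2, hC.d3, h0, h1, h2, h3, hT,
    ContinuousAlternatingMap.add_apply, ContinuousAlternatingMap.smul_apply,
    wedge_wedge_asForm_apply, smul_eq_mul, h.dual] at key
  refine ⟨?_, ?_, ?_, ?_⟩ <;> ext1 Y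
  · have k := key Y 0
    simp [hC.d0, h.dual, h0] at k
    simp
    linear_combination k
  · have k := key Y 1
    simp [hC.d1, h.dual, h1] at k
    simp
    linear_combination k
  · have k := key Y 2
    simp [hC.d2, h.dual, h2] at k
    simp
    linear_combination k
  · have k := key Y 3
    simp [hC.d3, h.dual, h3] at k
    simp
    linear_combination k

end Dim4

section Dim4

variable {C : StructureConstants} {F : Fin 4 → Coord 4} {Ef : Coord 4 → Fin 4 → Coord 4 →L[ℝ] ℝ}
  {g : Coord 4 → Coord 4 →L[ℝ] Coord 4 →L[ℝ] ℝ} {x : Coord 4}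
  {D : Fin 4 → Coord 4 →L[ℝ] Coord 4 →L[ℝ] ℝ}
  {T : Coord 4 → Coord 4 [⋀^Fin 3]→L[ℝ] ℝ} {t₀ t₁ : ℝ}

theorem differentiableAt_wedge_asForm (hD : ∀ a, HasFDerivAt (fun y => Ef y a) (D a) x)
    (i j : Fin 4) : DifferentiableAt ℝ (fun y => wedge (Ef y i) (asForm (Ef y j))) x :=
  (hasFDerivAt_wedge (hD i) (hasFDerivAt_asForm (hD j))).differentiableAt

theorem differentiableAt_wedge_wedge_asForm (hD : ∀ a, HasFDerivAt (fun y => Ef y a) (D a) x)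
    (i j k : Fin 4) :
    DifferentiableAt ℝ (fun y => wedge (Ef y i) (wedge (Ef y j) (asForm (Ef y k)))) x :=
  (hasFDerivAt_wedge (hD i) (hasFDerivAt_wedge (hD j)
    (hasFDerivAt_asForm (hD k)))).differentiableAt

/-- Algebraic conditions on the structure constants and the torsion under which
`p E^{01} + q E^{23}` is a closed conformal form with associated covector `-k E^0 + σ E^2`. -/
theorem StructureConstants.Holds.covDeriv_two_form (hC : C.Holds (Ef x) D)
    (h : IsOrthoFrame (g x) lorentz (Ef x) F)
    (hg : ∀ᶠ y in nhds x, g y = ∑ a, lorentz a • tensor (Ef y a) (Ef y a))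
    (hD : ∀ a, HasFDerivAt (fun y => Ef y a) (D a) x)
    (hT : T x = t₀ • wedge (Ef x 0) (wedge (Ef x 1) (asForm (Ef x 2))) +
      t₁ • wedge (Ef x 0) (wedge (Ef x 2) (asForm (Ef x 3))))
    (h131 : C.c131 = C.c030) (h313 : C.c313 = C.c212)
    {p q : Coord 4 → ℝ} {k σ : ℝ} (hp : HasFDerivAt p (k • Ef x 1) x)
    (hq : HasFDerivAt q (-σ • Ef x 3) x)
    (e1 : 1 / 2 * p x * (C.c210 + t₀) + q x * C.c030 = -σ)
    (e2 : p x * C.c212 + 1 / 2 * q x * (C.c032 - t₁) = k)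
    (e3 : 1 / 2 * q x * (C.c210 + t₀) = p x * C.c030)
    (e4 : 1 / 2 * p x * (C.c032 - t₁) = q x * C.c212) (X : Coord 4) :
    covDeriv (torsionConn g T) (fun y => p y • wedge (Ef y 0) (asForm (Ef y 1)) +
      q y • wedge (Ef y 2) (asForm (Ef y 3))) x X =
      wedge (g x X) (asForm (-k • Ef x 0 + σ • Ef x 2)) := by
  obtain ⟨n0, n1, n2, n3⟩ := hC.covDeriv_coframe h hg hD hT X
  have d01 := differentiableAt_wedge_asForm hD 0 1
  have d23 := differentiableAt_wedge_asForm hD 2 3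
  rw [covDeriv_add (hp.differentiableAt.fun_smul d01) (hq.differentiableAt.fun_smul d23),
    covDeriv_smul hp d01, covDeriv_smul hq d23, covDeriv_wedge_asForm (hD 0) (hD 1),
    covDeriv_wedge_asForm (hD 2) (hD 3), n0, n1, n2, n3, h131, h313]
  have hgX : g x X = -Ef x 0 X • Ef x 0 + Ef x 1 X • Ef x 1 + Ef x 2 X • Ef x 2 +
      Ef x 3 X • Ef x 3 := by
    ext1 Y
    simp [h.apply, Fin.sum_univ_four, lorentz]
  rw [hgX]
  ext v
  simp only [wedge_asForm_apply, ContinuousAlternatingMap.add_apply,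
    ContinuousAlternatingMap.smul_apply, smul_eq_mul, _root_.add_apply, _root_.smul_apply,
    _root_.sub_apply]
  generalize Ef x 0 X = u0, Ef x 1 X = u1, Ef x 2 X = u2, Ef x 3 X = u3
  generalize Ef x 0 (v 0) = v0, Ef x 1 (v 0) = v1, Ef x 2 (v 0) = v2, Ef x 3 (v 0) = v3,
    Ef x 0 (v 1) = w0, Ef x 1 (v 1) = w1, Ef x 2 (v 1) = w2, Ef x 3 (v 1) = w3
  -- The `E^{01}` and `E^{23}` components agree identically, by the choice of `dp` and `dq`. The
  -- conditions are needed only for the mixed components: `e1` and `e2` supply the terms of `X^♭ ∧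
  -- (-k E^0 + σ E^2)`, while `e3` and `e4` remove the others.
  linear_combination (u0 * (v0 * w2 - v2 * w0) - u1 * (v1 * w2 - v2 * w1)) * e1 +
    (u2 * (v0 * w2 - v2 * w0) + u3 * (v0 * w3 - v3 * w0)) * e2 +
    (u1 * (v0 * w3 - v3 * w0) - u0 * (v1 * w3 - v3 * w1)) * e3 +
    (-u3 * (v1 * w2 - v2 * w1) + u2 * (v1 * w3 - v3 * w1)) * e4

/-- Allows the coframe formula with torsion to be reused for the Levi-Civita connection. -/
theorem torsionConn_zero {n : ℕ} (g : Coord n → Coord n →L[ℝ] Coord n →L[ℝ] ℝ) :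
    torsionConn g (fun _ => 0) = leviCivita g := by
  ext x X Y : 3
  have : trilinear (0 : Coord n [⋀^Fin 3]→L[ℝ] ℝ) X Y = 0 := by
    ext1 Z
    simp [trilinear_apply]
  rw [torsionConn_apply, this]
  simp

/-- The divergence of `p E^{012} + q E^{023}`. -/
theorem StructureConstants.Holds.codiff_three_form (hC : C.Holds (Ef x) D)
    (h : IsOrthoFrame (g x) lorentz (Ef x) F)
    (hg : ∀ᶠ y in nhds x, g y = ∑ a, lorentz a • tensor (Ef y a) (Ef y a))
    (hD : ∀ a, HasFDerivAt (fun y => Ef y a) (D a) x)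
    {p q : Coord 4 → ℝ} {p₁ p₃ q₁ q₃ : ℝ} (hp : HasFDerivAt p (p₁ • Ef x 1 + p₃ • Ef x 3) x)
    (hq : HasFDerivAt q (q₁ • Ef x 1 + q₃ • Ef x 3) x)
    (e : p₁ + p x * C.c313 = q₃ + q x * C.c131) :
    codiff g (leviCivita g) (fun y => p y • wedge (Ef y 0) (wedge (Ef y 1) (asForm (Ef y 2))) +
      q y • wedge (Ef y 0) (wedge (Ef y 2) (asForm (Ef y 3)))) x = 0 := by
  have d1 := differentiableAt_wedge_wedge_asForm hD 0 1 2
  have d2 := differentiableAt_wedge_wedge_asForm hD 0 2 3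
  rw [← torsionConn_zero, h.codiff_eq]
  have n := hC.covDeriv_coframe (T := fun _ => 0) (t₀ := 0) (t₁ := 0) h hg hD (by simp)
  have n0 := fun X => (n X).1
  have n1 := fun X => (n X).2.1
  have n2 := fun X => (n X).2.2.1
  have n3 := fun X => (n X).2.2.2
  simp only [covDeriv_add (hp.differentiableAt.fun_smul d1) (hq.differentiableAt.fun_smul d2),
    covDeriv_smul hp d1, covDeriv_smul hq d2, covDeriv_wedge_wedge_asForm (hD 0) (hD 1) (hD 2),
    covDeriv_wedge_wedge_asForm (hD 0) (hD 2) (hD 3), n0, n1, n2, n3]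
  ext v
  have hv : ∀ X : Coord 4, Matrix.vecCons X v 0 = X ∧ Matrix.vecCons X v 1 = v 0 ∧
      Matrix.vecCons X v 2 = v 1 := fun X => ⟨rfl, rfl, rfl⟩
  simp only [Fin.sum_univ_four, lorentz, Matrix.cons_val, h.dual,
    ContinuousAlternatingMap.neg_apply, ContinuousAlternatingMap.curryLeft_apply_apply,
    wedge_wedge_asForm_apply, ContinuousAlternatingMap.add_apply,
    ContinuousAlternatingMap.smul_apply, smul_eq_mul, _root_.add_apply, _root_.smul_apply,
    _root_.sub_apply, hv, ContinuousAlternatingMap.coe_zero, Pi.zero_apply, Fin.reduceEq, if_true,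
    if_false]
  generalize Ef x 0 (v 0) = v0, Ef x 1 (v 0) = v1, Ef x 2 (v 0) = v2, Ef x 3 (v 0) = v3,
    Ef x 0 (v 1) = w0, Ef x 1 (v 1) = w1, Ef x 2 (v 1) = w2, Ef x 3 (v 1) = w3
  -- Only the `E^{02}` component of the divergence is not identically zero. Its vanishing, condition
  -- `e`, says that `q E^1 + p E^3` is closed; up to sign, the 3-form is the Hodge dual of that
  -- 1-form.
  linear_combination (v0 * w2 - v2 * w0) * e

end Dim4

/-! ### The Kerr-Sen coframe and its dual frame -/

section Region

variable {a b : ℝ} {I : Set ℝ} {Δ : ℝ → ℝ} {x : Coord 4}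

theorem isOpen_region (a b : ℝ) (hI : IsOpen I) : IsOpen (region a b I) := by
  have h1 : Continuous (rhoSq a) := by unfold rhoSq; fun_prop
  have h2 : Continuous (rhobSq a b) := by unfold rhobSq; fun_prop
  exact (hI.preimage (continuous_apply 1)).inter
    ((isOpen_lt continuous_const (continuous_apply 2)).inter
    ((isOpen_lt (continuous_apply 2) continuous_const).inter
    ((isOpen_lt continuous_const h1).inter (isOpen_lt continuous_const h2))))

/-- The non-degeneracy conditions at a point of the region. -/
structure Regular (a b : ℝ) (Δ : ℝ → ℝ) (x : Coord 4) : Prop where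
  rho_pos : 0 < rho a x
  rhob_pos : 0 < rhobSq a b x
  sin_pos : 0 < Real.sin (x 2)
  delta_pos : 0 < Δ (x 1)

theorem regular_of_mem_region (hpos : ∀ r ∈ I, 0 < Δ r) (hx : x ∈ region a b I) :
    Regular a b Δ x where
  rho_pos := Real.sqrt_pos.2 hx.2.2.2.1
  rhob_pos := hx.2.2.2.2
  sin_pos := Real.sin_pos_of_pos_of_lt_pi hx.2.1 hx.2.2.1
  delta_pos := hpos _ hx.1

theorem Regular.rhoSq_eq (h : Regular a b Δ x) : rhoSq a x = rho a x ^ 2 :=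
  (Real.sq_sqrt (Real.sqrt_pos.1 h.rho_pos).le).symm

theorem Regular.sqrt_pos (h : Regular a b Δ x) : 0 < √(Δ (x 1)) := Real.sqrt_pos.2 h.delta_pos

theorem Regular.delta_eq (h : Regular a b Δ x) : Δ (x 1) = √(Δ (x 1)) ^ 2 :=
  (Real.sq_sqrt h.delta_pos.le).symm

theorem Regular.rho_sq (h : Regular a b Δ x) :
    rho a x ^ 2 = x 1 ^ 2 + a ^ 2 * Real.cos (x 2) ^ 2 := by
  rw [← h.rhoSq_eq, rhoSq]

theorem Regular.rhobSq_eq (h : Regular a b Δ x) :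
    rhobSq a b x = rho a x ^ 2 + 2 * b * x 1 := by
  rw [← h.rhoSq_eq, rhobSq]

/-- Uses `r² + 2br + a² = ρ_b² + a² sin² θ`. In this form the duality relations and structure
equations become rational identities in `ρ`, `ρ_b²`, `√Δ`, `r`, `sin θ` and `cos θ`, with no
relation between them needed. -/
theorem formPhi_eq (a b : ℝ) (x : Coord 4) :
    formPhi a b x = a • dCoord 0 - (rhobSq a b x + a ^ 2 * Real.sin (x 2) ^ 2) • dCoord 3 := by
  rw [formPhi, rhobSq, rhoSq, Real.sin_sq]
  congr 2
  ring

theorem Regular.exp_dilaton (h : Regular a b Δ x) :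
    Real.exp (dilaton a b x) = rho a x ^ 2 / rhobSq a b x := by
  have : 0 < rho a x / √(rhobSq a b x) := div_pos h.rho_pos (Real.sqrt_pos.2 h.rhob_pos)
  rw [dilaton, two_mul, Real.exp_add, Real.exp_log this, ← sq, div_pow,
    Real.sq_sqrt h.rhob_pos.le]

/-- The frame dual to the coframe `e⁰, e¹, e², e³`. -/
noncomputable def frame (a b : ℝ) (Δ : ℝ → ℝ) (x : Coord 4) : Fin 4 → Coord 4 :=
  ![(1 / (rho a x * √(Δ (x 1)))) •
      ((rhobSq a b x + a ^ 2 * Real.sin (x 2) ^ 2) • partialVec 0 + a • partialVec 3),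
    (√(Δ (x 1)) / rho a x) • partialVec 1,
    -(a * Real.sin (x 2) / rho a x) • partialVec 0 -
      (1 / (rho a x * Real.sin (x 2))) • partialVec 3,
    (1 / rho a x) • partialVec 2]

theorem Regular.metric_eq (h : Regular a b Δ x) :
    metric a b Δ x = -tensor (coframe a b Δ x 0) (coframe a b Δ x 0)
      + tensor (coframe a b Δ x 1) (coframe a b Δ x 1)
      + tensor (coframe a b Δ x 2) (coframe a b Δ x 2)
      + tensor (coframe a b Δ x 3) (coframe a b Δ x 3) := by
  have hB := h.rhob_pos.ne'
  have hR := h.rho_pos.ne'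
  have hS := h.sqrt_pos.ne'
  ext v w
  simp only [metric, h.exp_dilaton, _root_.add_apply, _root_.smul_apply, _root_.neg_apply,
    tensor_apply, smul_eq_mul, coframe, Matrix.cons_val]
  have hΔ := h.delta_eq
  generalize √(Δ (x 1)) = S at hΔ hS ⊢
  rw [hΔ]
  field_simp
  ring

theorem Regular.metric_eq_sum (h : Regular a b Δ x) :
    metric a b Δ x = ∑ i, lorentz i • tensor (coframe a b Δ x i) (coframe a b Δ x i) := by
  rw [h.metric_eq]
  simp [Fin.sum_univ_four, lorentz]

theorem coframe_zero_apply (v : Coord 4) : coframe a b Δ x 0 v =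
    rho a x * √(Δ (x 1)) / rhobSq a b x * (v 0 - a * Real.sin (x 2) ^ 2 * v 3) := by
  simp [coframe, formT, dCoord]

theorem coframe_one_apply (v : Coord 4) : coframe a b Δ x 1 v =
    rho a x / √(Δ (x 1)) * v 1 := by
  simp [coframe, dCoord]

theorem coframe_two_apply (v : Coord 4) : coframe a b Δ x 2 v =
    rho a x * Real.sin (x 2) / rhobSq a b x *
      (a * v 0 - (rhobSq a b x + a ^ 2 * Real.sin (x 2) ^ 2) * v 3) := by
  simp [coframe, formPhi_eq, dCoord]

theorem coframe_three_apply (v : Coord 4) : coframe a b Δ x 3 v = rho a x * v 2 := by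
  simp [coframe, dCoord]

theorem Regular.isOrthoFrame (h : Regular a b Δ x) :
    IsOrthoFrame (metric a b Δ x) lorentz (coframe a b Δ x) (frame a b Δ x) where
  sq i := by fin_cases i <;> simp [lorentz]
  dual i j := by
    have hB := h.rhob_pos.ne'
    have hR := h.rho_pos.ne'
    have hS := h.sqrt_pos.ne'
    have hs := h.sin_pos.ne'
    fin_cases i <;> fin_cases j <;>
      simp [coframe_zero_apply, coframe_one_apply, coframe_two_apply, coframe_three_apply, frame,
        partialVec] <;> field_simp <;> simp
  eq_sum := h.metric_eq_sum

theorem eventually_metric_eq_sum (hI : IsOpen I) (hpos : ∀ r ∈ I, 0 < Δ r)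
    (hx : x ∈ region a b I) : ∀ᶠ y in nhds x,
    metric a b Δ y = ∑ i, lorentz i • tensor (coframe a b Δ y i) (coframe a b Δ y i) :=
  Filter.eventually_of_mem ((isOpen_region a b hI).mem_nhds hx) fun _ hy =>
    (regular_of_mem_region hpos hy).metric_eq_sum

end Region

/-! ### Derivatives and structure functions of the Kerr-Sen coframe -/

section Derivatives

variable {a b : ℝ} {Δ : ℝ → ℝ} {x : Coord 4} {d : ℝ}

theorem hasFDerivAt_coord {n : ℕ} (i : Fin n) (x : Coord n) :
    HasFDerivAt (fun y : Coord n => y i) (dCoord i) x :=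
  (dCoord i : Coord n →L[ℝ] ℝ).hasFDerivAt

theorem hasFDerivAt_div {n : ℕ} {f g : Coord n → ℝ} {f' g' : Coord n →L[ℝ] ℝ} {x : Coord n}
    (hf : HasFDerivAt f f' x) (hg : HasFDerivAt g g' x) (h : g x ≠ 0) :
    HasFDerivAt (fun y => f y / g y) ((1 / g x) • f' - (f x / g x ^ 2) • g') x := by
  have := hf.fun_mul ((hasDerivAt_inv h).comp_hasFDerivAt x hg)
  simp only [div_eq_mul_inv]
  refine this.congr_fderiv ?_
  ext v
  simp
  ring

theorem hasFDerivAt_sin {n : ℕ} (i : Fin n) (x : Coord n) :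
    HasFDerivAt (fun y : Coord n => Real.sin (y i)) (Real.cos (x i) • dCoord i) x :=
  (hasFDerivAt_coord i x).sin

theorem hasFDerivAt_cos {n : ℕ} (i : Fin n) (x : Coord n) :
    HasFDerivAt (fun y : Coord n => Real.cos (y i)) (-Real.sin (x i) • dCoord i) x :=
  (hasFDerivAt_coord i x).cos

theorem hasFDerivAt_rhoSq (a : ℝ) (x : Coord 4) : HasFDerivAt (rhoSq a)
    ((2 * x 1) • dCoord 1 - (2 * a ^ 2 * Real.cos (x 2) * Real.sin (x 2)) • dCoord 2) x := by
  have := ((hasFDerivAt_coord 1 x).pow 2).fun_add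
    (((hasFDerivAt_cos 2 x).pow 2).const_mul (a ^ 2))
  refine this.congr_fderiv ?_
  ext v
  simp
  ring

theorem hasFDerivAt_rhobSq (a b : ℝ) (x : Coord 4) : HasFDerivAt (rhobSq a b)
    ((2 * (x 1 + b)) • dCoord 1 - (2 * a ^ 2 * Real.cos (x 2) * Real.sin (x 2)) • dCoord 2) x := by
  have := (hasFDerivAt_rhoSq a x).fun_add ((hasFDerivAt_coord 1 x).const_mul (2 * b))
  refine this.congr_fderiv ?_
  ext v
  simp
  ring

theorem Regular.hasFDerivAt_rho (h : Regular a b Δ x) : HasFDerivAt (rho a)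
    ((x 1 / rho a x) • dCoord 1
      - (a ^ 2 * Real.cos (x 2) * Real.sin (x 2) / rho a x) • dCoord 2) x := by
  have := (hasFDerivAt_rhoSq a x).sqrt (Real.sqrt_pos.1 h.rho_pos).ne'
  refine this.congr_fderiv ?_
  have hR := h.rho_pos.ne'
  ext v
  simp only [_root_.smul_apply, _root_.sub_apply, smul_eq_mul]
  change 1 / (2 * rho a x) * _ = _
  field_simp

theorem Regular.hasFDerivAt_sqrt (h : Regular a b Δ x) (hd : HasDerivAt Δ d (x 1)) :
    HasFDerivAt (fun y : Coord 4 => √(Δ (y 1))) ((d / (2 * √(Δ (x 1)))) • dCoord 1) x := by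
  have := (hd.sqrt h.delta_pos.ne').comp_hasFDerivAt x (hasFDerivAt_coord 1 x)
  exact this

/-- The derivative of the coframe, where `d` is the derivative of `Δ`. -/
noncomputable def coframeDeriv (a b : ℝ) (Δ : ℝ → ℝ) (d : ℝ) (x : Coord 4) :
    Fin 4 → Coord 4 →L[ℝ] Coord 4 →L[ℝ] ℝ :=
  let R := rho a x
  let S := √(Δ (x 1))
  let B := rhobSq a b x
  let r := x 1
  let c := Real.cos (x 2)
  let s := Real.sin (x 2)
  ![(R * S / B) • (-(2 * a * s * c) • dCoord 2).smulRight (dCoord 3) +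
      ((r / R * S / B + R * (d / (2 * S)) / B - R * S * (2 * (r + b)) / B ^ 2) • dCoord 1 +
        (-(a ^ 2 * c * s / R) * S / B + R * S * (2 * a ^ 2 * c * s) / B ^ 2) •
          dCoord 2).smulRight (formT a x),
    ((r / R / S - R * (d / (2 * S)) / S ^ 2) • dCoord 1 -
      (a ^ 2 * c * s / R / S) • dCoord 2).smulRight (dCoord 1),
    (R * s / B) • (-(2 * (r + b)) • dCoord 1).smulRight (dCoord 3) +
      ((r / R * s / B - R * s * (2 * (r + b)) / B ^ 2) • dCoord 1 +
        (-(a ^ 2 * c * s / R) * s / B + R * c / B + R * s * (2 * a ^ 2 * c * s) / B ^ 2) •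
          dCoord 2).smulRight (formPhi a b x),
    ((r / R) • dCoord 1 - (a ^ 2 * c * s / R) • dCoord 2).smulRight (dCoord 2)]

theorem Regular.hasFDerivAt_coframe (h : Regular a b Δ x) (hd : HasDerivAt Δ d (x 1))
    (i : Fin 4) :
    HasFDerivAt (fun y => coframe a b Δ y i) (coframeDeriv a b Δ d x i) x := by
  have hB := h.rhob_pos.ne'
  have hR := h.rho_pos.ne'
  have hS := h.sqrt_pos.ne'
  have dR := h.hasFDerivAt_rho
  have dS := h.hasFDerivAt_sqrt hd
  have dB := hasFDerivAt_rhobSq a b x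
  have ds := hasFDerivAt_sin 2 x
  have dr := hasFDerivAt_coord 1 x
  fin_cases i
  · have h1 : HasFDerivAt (formT a)
        ((-(2 * a * Real.sin (x 2) * Real.cos (x 2)) • dCoord 2).smulRight (dCoord 3)) x := by
      have := (((ds.pow 2).const_mul a).smul_const
        (dCoord 3 : Coord 4 →L[ℝ] ℝ)).const_sub (dCoord 0)
      refine this.congr_fderiv ?_
      ext v w
      simp [-mul_eq_mul_right_iff]
      ring
    refine ((hasFDerivAt_div (dR.fun_mul dS) dB hB).fun_smul h1).congr_fderiv ?_
    ext v w
    change _ = coframeDeriv a b Δ d x 0 v w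
    simp only [coframeDeriv, Matrix.cons_val, _root_.add_apply, _root_.sub_apply,
      _root_.smul_apply, ContinuousLinearMap.smulRight_apply, smul_eq_mul]
    field_simp
    ring
  · refine ((hasFDerivAt_div dR dS hS).smul_const (dCoord 1)).congr_fderiv ?_
    ext v w
    change _ = coframeDeriv a b Δ d x 1 v w
    simp only [coframeDeriv, Matrix.cons_val, _root_.sub_apply, _root_.smul_apply,
      ContinuousLinearMap.smulRight_apply, smul_eq_mul]
    field_simp
    ring
  · have h1 : HasFDerivAt (formPhi a b)
        ((-(2 * (x 1 + b)) • dCoord 1).smulRight (dCoord 3)) x := by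
      have := ((((dr.pow 2).fun_add (dr.const_mul (2 * b))).add_const (a ^ 2)).smul_const
        (dCoord 3 : Coord 4 →L[ℝ] ℝ)).const_sub (a • dCoord 0)
      refine this.congr_fderiv ?_
      ext v w
      simp [-mul_eq_mul_right_iff]
      ring
    refine ((hasFDerivAt_div (dR.fun_mul ds) dB hB).fun_smul h1).congr_fderiv ?_
    ext v w
    change _ = coframeDeriv a b Δ d x 2 v w
    simp only [coframeDeriv, Matrix.cons_val, _root_.add_apply, _root_.sub_apply,
      _root_.smul_apply, ContinuousLinearMap.smulRight_apply, smul_eq_mul]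
    field_simp
    ring
  · refine (dR.smul_const (dCoord 2)).congr_fderiv ?_
    ext v w
    simp [coframeDeriv]

/-- The structure constants of the Kerr-Sen coframe, where `d` is the derivative of `Δ`. -/
noncomputable def structureConstants (a b : ℝ) (Δ : ℝ → ℝ) (d : ℝ) (x : Coord 4) :
    StructureConstants :=
  let R := rho a x
  let S := √(Δ (x 1))
  let B := rhobSq a b x
  let r := x 1
  let c := Real.cos (x 2)
  let s := Real.sin (x 2)
  { c010 := S / R * (r / R ^ 2 + d / (2 * S ^ 2) - 2 * (r + b) / B)
    c030 := -(a ^ 2 * c * s / R ^ 3)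
    c032 := 2 * a * c * S / (B * R)
    c131 := -(a ^ 2 * c * s / R ^ 3)
    c210 := -(2 * a * s * (r + b) / (B * R))
    c212 := S * r / R ^ 3
    c232 := 1 / R * (-(a ^ 2 * c * s / R ^ 2) + c / s + 2 * a ^ 2 * c * s / B)
    c313 := S * r / R ^ 3 }

theorem Regular.structureConstants_holds (h : Regular a b Δ x) :
    (structureConstants a b Δ d x).Holds (coframe a b Δ x) (coframeDeriv a b Δ d x) := by
  have hB := h.rhob_pos.ne'
  have hR := h.rho_pos.ne'
  have hS := h.sqrt_pos.ne'
  have hs := h.sin_pos.ne'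
  constructor <;> intro X Y <;>
    simp only [coframe_zero_apply, coframe_one_apply, coframe_two_apply, coframe_three_apply,
      structureConstants, coframeDeriv, Matrix.cons_val, formT, formPhi_eq, dCoord,
      _root_.add_apply, _root_.sub_apply, _root_.smul_apply, ContinuousLinearMap.smulRight_apply,
      ContinuousLinearMap.proj_apply, smul_eq_mul] <;>
    field_simp <;> ring

end Derivatives

/-! ### The torsions `T_±` and the covariant derivatives of `h_±` -/

section Torsion

variable {a b s : ℝ} {I : Set ℝ} {Δ : ℝ → ℝ} {x : Coord 4}

theorem wedge_frame_apply (a b : ℝ) (Δ : ℝ → ℝ) (x : Coord 4) (i j k : Fin 4) :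
    e3 a b Δ i j k x = wedge (coframe a b Δ x i) (wedge (coframe a b Δ x j)
      (asForm (coframe a b Δ x k))) := rfl

theorem Regular.fieldH_eq (h : Regular a b Δ x) :
    fieldH a b Δ x = T0 1 a b x • e3 a b Δ 0 1 2 x + T1 1 a b Δ x • e3 a b Δ 0 2 3 x := by
  have hB := h.rhob_pos.ne'
  have hR := h.rho_pos.ne'
  have hS := h.sqrt_pos.ne'
  have hΔ := h.delta_eq
  have e1 := h.rho_sq
  have e2 := h.rhobSq_eq
  ext v
  simp only [fieldH, T0, T1, wedge_frame_apply, wedge_wedge_asForm_apply,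
    ContinuousAlternatingMap.add_apply, ContinuousAlternatingMap.smul_apply, smul_eq_mul,
    coframe_zero_apply, coframe_one_apply, coframe_two_apply, coframe_three_apply, dCoord,
    _root_.sub_apply, _root_.smul_apply, ContinuousLinearMap.proj_apply, Real.sin_two_mul,
    h.rhoSq_eq]
  generalize √(Δ (x 1)) = S at hΔ hS ⊢
  rw [hΔ]
  -- Replacing `a² cos² θ` by `ρ² - r²`, `ρ_b²` by `ρ² + 2br` and `Δ` by `(√Δ)²` leaves a rational
  -- identity in independent variables.
  have k1 : a ^ 2 * Real.cos (x 2) ^ 2 = rho a x ^ 2 - x 1 ^ 2 := by rw [e1]; ring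
  have k2 : 2 * b * x 1 = rhobSq a b x - rho a x ^ 2 := by rw [e2]; ring
  rw [k1]
  generalize rhobSq a b x = B at *
  generalize rho a x = R at *
  generalize Real.sin (x 2) = s, Real.cos (x 2) = c, x 1 = r at *
  generalize v 0 0 = a0, v 0 1 = a1, v 0 2 = a2, v 0 3 = a3, v 1 0 = b0, v 1 1 = b1, v 1 2 = b2,
    v 1 3 = b3, v 2 0 = c0, v 2 1 = c1, v 2 2 = c2, v 2 3 = c3
  subst e2
  field_simp
  ring

/-- For a torsion with value `T_± = T_0^± e^{012} + T_1^± e^{023}`, where `s = ±1` is the sign,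
`∇_X h_± = X^♭ ∧ ξ_±`. -/
theorem Regular.hForm_covDeriv {d : ℝ} (h : Regular a b Δ x) (hd : HasDerivAt Δ d (x 1))
    (hs : s * s = 1) {T : Coord 4 → Coord 4 [⋀^Fin 3]→L[ℝ] ℝ}
    (hg : ∀ᶠ y in nhds x,
      metric a b Δ y = ∑ i, lorentz i • tensor (coframe a b Δ y i) (coframe a b Δ y i))
    (hT : T x = T0 s a b x • e3 a b Δ 0 1 2 x + T1 s a b Δ x • e3 a b Δ 0 2 3 x) (X : Coord 4) :
    covDeriv (torsionConn (metric a b Δ) T) (hForm s a b Δ) x X =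
      wedge (metric a b Δ x X) (asForm (xi s a b Δ x)) := by
  have hB := h.rhob_pos.ne'
  have hR := h.rho_pos.ne'
  have hS := h.sqrt_pos.ne'
  have k1 : a ^ 2 * Real.cos (x 2) ^ 2 = rho a x ^ 2 - x 1 ^ 2 := by rw [h.rho_sq]; ring
  -- The first term of `T_0^±` is exactly `-c210`, and that of `T_1^±` is `c032`. What remains is
  -- free of `b` and carries the sign `s`.
  have t0 : (structureConstants a b Δ d x).c210 + T0 s a b x =
      -(s * (2 * a * Real.sin (x 2) * x 1 / rho a x ^ 3)) := by
    simp only [structureConstants, T0, h.rhoSq_eq]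
    field_simp
    ring
  have t1 : (structureConstants a b Δ d x).c032 - T1 s a b Δ x =
      s * (2 * a * Real.cos (x 2) * √(Δ (x 1)) / rho a x ^ 3) := by
    simp only [structureConstants, T1, h.rhoSq_eq]
    field_simp
    ring
  -- `k` and `σ` are read off from `dr = (√Δ / ρ) e^1` and `d(s a cos θ) = -s (a sin θ / ρ) e^3`.
  -- The algebraic conditions then reduce to `r² + a² cos² θ = ρ²` and `s² = 1`.
  refine h.structureConstants_holds.covDeriv_two_form (k := √(Δ (x 1)) / rho a x)
    (σ := s * (a * Real.sin (x 2) / rho a x)) h.isOrthoFrame hg (h.hasFDerivAt_coframe hd) hT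
    rfl rfl ?_ ?_ ?_ ?_ ?_ ?_ X
  · refine (hasFDerivAt_coord 1 x).congr_fderiv ?_
    ext v
    simp only [_root_.smul_apply, coframe_one_apply, dCoord, ContinuousLinearMap.proj_apply,
      smul_eq_mul]
    field_simp
  · refine (((hasFDerivAt_cos 2 x).const_mul a).const_mul s).congr_fderiv ?_
    ext v
    simp only [_root_.smul_apply, coframe_three_apply, dCoord, ContinuousLinearMap.proj_apply,
      smul_eq_mul]
    field_simp
  · rw [t0]
    simp only [structureConstants]
    field_simp
    linear_combination (-a * s * Real.sin (x 2)) * k1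
  · rw [t1]
    simp only [structureConstants]
    field_simp
    linear_combination k1 + a ^ 2 * Real.cos (x 2) ^ 2 * hs
  · rw [t0]
    simp only [structureConstants]
    field_simp
    linear_combination (-a^2 * Real.sin (x 2) * Real.cos (x 2) * x 1) * hs
  · rw [t1]
    simp only [structureConstants]
    field_simp

end Torsion

/-! ### The GCCKY property of `h_±` -/

section Conclusions

variable {a b s d : ℝ} {I : Set ℝ} {Δ : ℝ → ℝ} {x : Coord 4}

theorem hasDerivAt_of_mem_region (hI : IsOpen I) (hΔ : DifferentiableOn ℝ Δ I)
    (hx : x ∈ region a b I) : HasDerivAt Δ (deriv Δ (x 1)) (x 1) :=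
  (hΔ.differentiableAt (hI.mem_nhds hx.1)).hasDerivAt

theorem isMetricOn_metric (hI : IsOpen I) (hΔ : DifferentiableOn ℝ Δ I)
    (hpos : ∀ r ∈ I, 0 < Δ r) : IsMetricOn (region a b I) (metric a b Δ) := by
  refine ⟨fun x hx => ?_, fun x hx => (regular_of_mem_region hpos hx).isOrthoFrame.symm,
    fun x hx => (regular_of_mem_region hpos hx).isOrthoFrame.nondegenerate⟩
  have h := regular_of_mem_region hpos hx
  have : DifferentiableAt ℝ
      (fun y => ∑ i, lorentz i • tensor (coframe a b Δ y i) (coframe a b Δ y i)) x := by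
    refine DifferentiableAt.fun_sum fun i _ => ?_
    have := (h.hasFDerivAt_coframe (hasDerivAt_of_mem_region hI hΔ hx) i).differentiableAt
    unfold tensor
    fun_prop
  exact (this.congr_of_eventuallyEq
    (eventually_metric_eq_sum hI hpos hx)).differentiableWithinAt

theorem Regular.differentiableAt_e2 (h : Regular a b Δ x) (hd : HasDerivAt Δ d (x 1))
    (i j : Fin 4) : DifferentiableAt ℝ (e2 a b Δ i j) x :=
  differentiableAt_wedge_asForm (h.hasFDerivAt_coframe hd) i j

theorem Regular.differentiableAt_e3 (h : Regular a b Δ x) (hd : HasDerivAt Δ d (x 1))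
    (i j k : Fin 4) : DifferentiableAt ℝ (e3 a b Δ i j k) x :=
  differentiableAt_wedge_wedge_asForm (h.hasFDerivAt_coframe hd) i j k

theorem Regular.differentiableAt_hForm (h : Regular a b Δ x) (hd : HasDerivAt Δ d (x 1)) :
    DifferentiableAt ℝ (hForm s a b Δ) x :=
  ((hasFDerivAt_coord 1 x).differentiableAt.fun_smul (h.differentiableAt_e2 hd 0 1)).fun_add
    ((((hasFDerivAt_cos 2 x).const_mul a).const_mul s).differentiableAt.fun_smul
      (h.differentiableAt_e2 hd 2 3))

/-- For the torsion `T_±` the form `h_±` is a generalized closed conformal Killing-Yano form with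
associated covector `ξ_±`. -/
theorem hForm_isGCCKY (hI : IsOpen I) (hΔ : DifferentiableOn ℝ Δ I)
    (hpos : ∀ r ∈ I, 0 < Δ r) (hs : s * s = 1) {T : Coord 4 → Coord 4 [⋀^Fin 3]→L[ℝ] ℝ}
    (hT : ∀ x ∈ region a b I,
      T x = T0 s a b x • e3 a b Δ 0 1 2 x + T1 s a b Δ x • e3 a b Δ 0 2 3 x) :
    IsGCCKY (region a b I) (metric a b Δ) T (hForm s a b Δ) ∧
      ∀ x ∈ region a b I,
        (∀ X, covDeriv (torsionConn (metric a b Δ) T) (hForm s a b Δ) x X =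
          wedge (metric a b Δ x X) (asForm (xi s a b Δ x))) ∧
        asForm (xi s a b Δ x) = -(1 / 3 : ℝ) • codiff (metric a b Δ)
          (torsionConn (metric a b Δ) T) (hForm s a b Δ) x := by
  have key : ∀ x ∈ region a b I, ∀ X,
      covDeriv (torsionConn (metric a b Δ) T) (hForm s a b Δ) x X =
        wedge (metric a b Δ x X) (asForm (xi s a b Δ x)) := fun x hx =>
    (regular_of_mem_region hpos hx).hForm_covDeriv (hasDerivAt_of_mem_region hI hΔ hx) hs
      (eventually_metric_eq_sum hI hpos hx) (hT x hx)
  have hext : ∀ x ∈ region a b I,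
      extCov (torsionConn (metric a b Δ) T) (hForm s a b Δ) x = 0 := fun x hx =>
    extCov_eq_zero_of_covDeriv_eq_wedge (regular_of_mem_region hpos hx).isOrthoFrame.symm
      (key x hx)
  have hco : ∀ x ∈ region a b I,
      codiff (metric a b Δ) (torsionConn (metric a b Δ) T) (hForm s a b Δ) x =
        (-3 : ℝ) • asForm (xi s a b Δ x) := fun x hx => by
    rw [(regular_of_mem_region hpos hx).isOrthoFrame.codiff_eq_of_covDeriv_eq_wedge (key x hx)]
    norm_num
  refine ⟨⟨⟨fun x hx => ((regular_of_mem_region hpos hx).differentiableAt_hForm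
    (hasDerivAt_of_mem_region hI hΔ hx)).differentiableWithinAt, fun x hx X => ?_⟩, hext⟩,
    fun x hx => ⟨key x hx, ?_⟩⟩
  · rw [key x hx, hext x hx, hco x hx]
    -- For a 2-form in dimension four the coefficient is `1 / (4 - 1)`, which cancels the factor in
    -- `δ^T h = -3 ξ`.
    have h0 : (0 : Coord 4 [⋀^Fin 3]→L[ℝ] ℝ).curryLeft X = 0 := rfl
    rw [h0, smul_zero, sub_zero, ← wedgeCLM_apply, ← wedgeCLM_apply, map_smul, smul_smul]
    norm_num
  · rw [hco x hx, smul_smul]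
    norm_num

/-- Since `e^0(∂_t) = ρ√Δ / ρ_b²` and `e^2(∂_t) = aρ sin θ / ρ_b²`, lowering the index of `∂_t`
gives `ρ² / ρ_b² = e^Φ` times `ξ_+`. -/
theorem Regular.sharp_xi (h : Regular a b Δ x) :
    sharp (metric a b Δ) x (xi 1 a b Δ x) = Real.exp (-dilaton a b x) • partialVec 0 := by
  have hB := h.rhob_pos.ne'
  have hR := h.rho_pos.ne'
  have hS := h.sqrt_pos.ne'
  have : xi 1 a b Δ x = Real.exp (-dilaton a b x) • metric a b Δ x (partialVec 0) := by
    rw [Real.exp_neg, h.exp_dilaton, h.metric_eq]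
    ext v
    simp only [xi, tensor_apply, _root_.add_apply, _root_.neg_apply, _root_.smul_apply,
      smul_eq_mul]
    simp only [coframe_zero_apply, coframe_one_apply, coframe_two_apply, coframe_three_apply,
      partialVec, Pi.single_apply, Fin.reduceEq, if_true, if_false]
    field_simp
    ring
  rw [this, map_smul, h.isOrthoFrame.sharp_metric]

/-! ### Distinctness of `T_+` and `T_-` -/

theorem Regular.e3_frame (h : Regular a b Δ x) (i j k l m n : Fin 4) :
    e3 a b Δ i j k x ![frame a b Δ x l, frame a b Δ x m, frame a b Δ x n] =
      (if i = l then 1 else 0) * ((if j = m then 1 else 0) * (if k = n then 1 else 0)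
        - (if j = n then 1 else 0) * (if k = m then 1 else 0))
      - (if i = m then 1 else 0) * ((if j = l then 1 else 0) * (if k = n then 1 else 0)
        - (if j = n then 1 else 0) * (if k = l then 1 else 0))
      + (if i = n then 1 else 0) * ((if j = l then 1 else 0) * (if k = m then 1 else 0)
        - (if j = m then 1 else 0) * (if k = l then 1 else 0)) := by
  rw [wedge_frame_apply, wedge_wedge_asForm_apply]
  simp only [Matrix.cons_val, h.isOrthoFrame.dual]

/-- The forms `e^{012}` and `e^{023}` are linearly independent. -/
theorem Regular.eq_of_combination_eq (h : Regular a b Δ x) {p q p' q' : ℝ}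
    (he : p • e3 a b Δ 0 1 2 x + q • e3 a b Δ 0 2 3 x =
      p' • e3 a b Δ 0 1 2 x + q' • e3 a b Δ 0 2 3 x) : p = p' ∧ q = q' := by
  have h1 := congrArg (fun ω => ω ![frame a b Δ x 0, frame a b Δ x 1, frame a b Δ x 2]) he
  have h2 := congrArg (fun ω => ω ![frame a b Δ x 0, frame a b Δ x 2, frame a b Δ x 3]) he
  simp only [ContinuousAlternatingMap.add_apply, ContinuousAlternatingMap.smul_apply,
    h.e3_frame, Fin.reduceEq, if_true, if_false, smul_eq_mul] at h1 h2
  constructor <;> linarith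

theorem Regular.coord_or_cos_ne_zero (h : Regular a b Δ x) : x 1 ≠ 0 ∨ Real.cos (x 2) ≠ 0 := by
  by_contra! hc
  have := h.rho_sq
  rw [hc.1, hc.2] at this
  have := h.rho_pos
  nlinarith

/-- The difference `T_+ - T_-` equals `-(4a / ρ³) (r sin θ e^{012} + cos θ √Δ e^{023})`, in which
the `b`-dependent terms of the coefficients have cancelled. It could vanish for `a ≠ 0` only if `r =
cos θ = 0`, which `ρ² > 0` excludes. -/
theorem Regular.torsionMinus_ne (h : Regular a b Δ x) (ha : a ≠ 0) :
    torsionMinus a b Δ x ≠ fieldH a b Δ x := by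
  have hR := h.rho_pos.ne'
  have hS := h.sqrt_pos.ne'
  have hs := h.sin_pos.ne'
  rw [h.fieldH_eq]
  intro he
  obtain ⟨h0, h1⟩ := h.eq_of_combination_eq he
  have k0 : a * Real.sin (x 2) * x 1 = 0 := by
    have : T0 1 a b x - T0 (-1) a b x = -4 / rho a x ^ 3 * (a * Real.sin (x 2) * x 1) := by
      rw [T0, T0, h.rhoSq_eq]
      field_simp
      ring
    rw [h0, sub_self] at this
    simpa [hR] using this.symm
  have k1 : a * Real.cos (x 2) * √(Δ (x 1)) = 0 := by
    have : T1 1 a b Δ x - T1 (-1) a b Δ x =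
        -4 / rho a x ^ 3 * (a * Real.cos (x 2) * √(Δ (x 1))) := by
      rw [T1, T1, h.rhoSq_eq]
      field_simp
      ring
    rw [h1, sub_self] at this
    simpa [hR] using this.symm
  rcases h.coord_or_cos_ne_zero with hr | hc
  · exact mul_ne_zero (mul_ne_zero ha hs) hr k0
  · exact mul_ne_zero (mul_ne_zero ha hc) hS k1

/-! ### The Kerr limit `b = 0` -/

theorem Regular.T0_kerr (h : Regular a 0 Δ x) :
    T0 (-1) a 0 x = 4 * a / rho a x ^ 3 * (x 1 * Real.sin (x 2)) := by
  have hR := h.rho_pos.ne'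
  rw [T0, h.rhobSq_eq, h.rhoSq_eq]
  simp only [mul_zero, zero_mul, add_zero]
  field_simp
  ring

theorem Regular.T1_kerr (h : Regular a 0 Δ x) :
    T1 (-1) a 0 Δ x = 4 * a / rho a x ^ 3 * (Real.cos (x 2) * √(Δ (x 1))) := by
  have hR := h.rho_pos.ne'
  rw [T1, h.rhobSq_eq, h.rhoSq_eq]
  simp only [mul_zero, zero_mul, add_zero]
  field_simp
  ring

theorem Regular.torsionMinus_kerr (h : Regular a 0 Δ x) :
    torsionMinus a 0 Δ x = (4 * a / rho a x ^ 3) • ((x 1 * Real.sin (x 2)) • e3 a 0 Δ 0 1 2 x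
      + (Real.cos (x 2) * √(Δ (x 1))) • e3 a 0 Δ 0 2 3 x) := by
  rw [torsionMinus, h.T0_kerr, h.T1_kerr, smul_add, smul_smul, smul_smul]

theorem Regular.torsionMinus_kerr_ne_zero (h : Regular a 0 Δ x) (ha : a ≠ 0) :
    torsionMinus a 0 Δ x ≠ 0 := by
  have hR := h.rho_pos.ne'
  have hS := h.sqrt_pos.ne'
  have hs := h.sin_pos.ne'
  intro he
  obtain ⟨h0, h1⟩ := h.eq_of_combination_eq (p' := 0) (q' := 0) (he.trans (by simp))
  rw [h.T0_kerr] at h0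
  rw [h.T1_kerr] at h1
  rcases h.coord_or_cos_ne_zero with hr | hc
  · exact mul_ne_zero (div_ne_zero (mul_ne_zero four_ne_zero ha) (pow_ne_zero 3 hR))
      (mul_ne_zero hr hs) h0
  · exact mul_ne_zero (div_ne_zero (mul_ne_zero four_ne_zero ha) (pow_ne_zero 3 hR))
      (mul_ne_zero hc hS) h1

theorem Regular.hasFDerivAt_T0_kerr (h : Regular a b Δ x) :
    HasFDerivAt (fun y => 4 * a / rho a y ^ 3 * (y 1 * Real.sin (y 2)))
      ((4 * a * Real.sin (x 2) * √(Δ (x 1)) * (rho a x ^ 2 - 3 * x 1 ^ 2) / rho a x ^ 6) •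
        coframe a b Δ x 1 +
      (4 * a * x 1 * Real.cos (x 2) * (rho a x ^ 2 + 3 * a ^ 2 * Real.sin (x 2) ^ 2) /
        rho a x ^ 6) • coframe a b Δ x 3) x := by
  have hR := h.rho_pos.ne'
  have hS := h.sqrt_pos.ne'
  have := (hasFDerivAt_div (hasFDerivAt_const (4 * a) x) (h.hasFDerivAt_rho.pow 3)
    (pow_ne_zero 3 hR)).fun_mul ((hasFDerivAt_coord 1 x).fun_mul (hasFDerivAt_sin 2 x))
  refine this.congr_fderiv ?_
  ext v
  simp only [_root_.add_apply, _root_.sub_apply, _root_.smul_apply, smul_eq_mul, nsmul_eq_mul,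
    coframe_one_apply, coframe_three_apply, dCoord, ContinuousLinearMap.proj_apply, smul_zero,
    _root_.zero_apply]
  field_simp
  push_cast
  ring

theorem Regular.hasFDerivAt_T1_kerr (h : Regular a b Δ x) (hd : HasDerivAt Δ d (x 1)) :
    HasFDerivAt (fun y => 4 * a / rho a y ^ 3 * (Real.cos (y 2) * √(Δ (y 1))))
      ((4 * a * Real.cos (x 2) * (d / 2 * rho a x ^ 2 - 3 * x 1 * √(Δ (x 1)) ^ 2) /
        rho a x ^ 6) • coframe a b Δ x 1 +
      (4 * a * √(Δ (x 1)) * Real.sin (x 2) *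
        (3 * a ^ 2 * Real.cos (x 2) ^ 2 - rho a x ^ 2) / rho a x ^ 6) •
        coframe a b Δ x 3) x := by
  have hR := h.rho_pos.ne'
  have hS := h.sqrt_pos.ne'
  have := (hasFDerivAt_div (hasFDerivAt_const (4 * a) x) (h.hasFDerivAt_rho.pow 3)
    (pow_ne_zero 3 hR)).fun_mul ((hasFDerivAt_cos 2 x).fun_mul (h.hasFDerivAt_sqrt hd))
  refine this.congr_fderiv ?_
  ext v
  simp only [_root_.add_apply, _root_.sub_apply, _root_.smul_apply, smul_eq_mul, nsmul_eq_mul,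
    coframe_one_apply, coframe_three_apply, dCoord, ContinuousLinearMap.proj_apply, smul_zero,
    _root_.zero_apply]
  field_simp
  push_cast
  ring

theorem eventually_torsionMinus_kerr (hI : IsOpen I) (hpos : ∀ r ∈ I, 0 < Δ r)
    (hx : x ∈ region a 0 I) : torsionMinus a 0 Δ =ᶠ[nhds x] fun y =>
      (4 * a / rho a y ^ 3 * (y 1 * Real.sin (y 2))) • e3 a 0 Δ 0 1 2 y +
      (4 * a / rho a y ^ 3 * (Real.cos (y 2) * √(Δ (y 1)))) • e3 a 0 Δ 0 2 3 y :=
  Filter.eventually_of_mem ((isOpen_region a 0 hI).mem_nhds hx) fun y hy => by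
    have h := regular_of_mem_region hpos hy
    rw [torsionMinus, h.T0_kerr, h.T1_kerr]

theorem differentiableOn_torsionMinus_kerr (hI : IsOpen I) (hΔ : DifferentiableOn ℝ Δ I)
    (hpos : ∀ r ∈ I, 0 < Δ r) : DifferentiableOn ℝ (torsionMinus a 0 Δ) (region a 0 I) :=
  fun x hx => by
    have h := regular_of_mem_region hpos hx
    have hd := hasDerivAt_of_mem_region hI hΔ hx
    refine (DifferentiableAt.congr_of_eventuallyEq ?_
      (eventually_torsionMinus_kerr hI hpos hx)).differentiableWithinAt
    exact (h.hasFDerivAt_T0_kerr.differentiableAt.fun_smul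
      (h.differentiableAt_e3 hd 0 1 2)).fun_add
      ((h.hasFDerivAt_T1_kerr hd).differentiableAt.fun_smul (h.differentiableAt_e3 hd 0 2 3))

theorem covDeriv_congr {n p : ℕ} {A : Coord n → Coord n →L[ℝ] Coord n →L[ℝ] Coord n}
    {ω ζ : Coord n → Coord n [⋀^Fin p]→L[ℝ] ℝ} {x : Coord n} (h : ω =ᶠ[nhds x] ζ) :
    covDeriv A ω x = covDeriv A ζ x := by
  rw [covDeriv, covDeriv, h.fderiv_eq, h.eq_of_nhds]

theorem codiff_torsionMinus_kerr (hI : IsOpen I) (hΔ : DifferentiableOn ℝ Δ I)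
    (hpos : ∀ r ∈ I, 0 < Δ r) (hx : x ∈ region a 0 I) :
    codiff (metric a 0 Δ) (leviCivita (metric a 0 Δ)) (torsionMinus a 0 Δ) x = 0 := by
  have h := regular_of_mem_region hpos hx
  have hd := hasDerivAt_of_mem_region hI hΔ hx
  have hR := h.rho_pos.ne'
  -- The closed forms of the coefficients hold near `x` and not merely at `x`, so they may be
  -- differentiated.
  rw [codiff, covDeriv_congr (eventually_torsionMinus_kerr hI hpos hx), ← codiff]
  refine h.structureConstants_holds.codiff_three_form h.isOrthoFrame
    (eventually_metric_eq_sum hI hpos hx) (h.hasFDerivAt_coframe hd) h.hasFDerivAt_T0_kerr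
    (h.hasFDerivAt_T1_kerr hd) ?_
  simp only [structureConstants]
  field_simp
  linear_combination (2 * a * Real.sin (x 2) * √(Δ (x 1))) * h.rho_sq

theorem Regular.torsionMinus_kerr_eq_hodgeStar (h : Regular a 0 Δ x) (hr : x 1 ≠ 0) :
    torsionMinus a 0 Δ x = hodgeStarOne (metric a 0 Δ) (volForm a 0 Δ) x
      (fderiv ℝ (fun y : Coord 4 => 4 * Real.arctan (a * Real.cos (y 2) / y 1)) x) := by
  have hR := h.rho_pos.ne'
  have hS := h.sqrt_pos.ne'
  -- In `dα` the factor `1 + (a cos θ / r)² = ρ² / r²` clears the denominator `r`. The minus signs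
  -- match the Hodge dual: contracting `e^{0123}` with `F_1` gives `-e^{023}`, and with `F_3` gives
  -- `-e^{012}`.
  have hf : HasFDerivAt (fun y : Coord 4 => 4 * Real.arctan (a * Real.cos (y 2) / y 1))
      (-(4 * a / rho a x ^ 3 * (Real.cos (x 2) * √(Δ (x 1)))) • coframe a 0 Δ x 1 -
        (4 * a / rho a x ^ 3 * (x 1 * Real.sin (x 2))) • coframe a 0 Δ x 3) x := by
    have := ((hasFDerivAt_div ((hasFDerivAt_cos 2 x).const_mul a) (hasFDerivAt_coord 1 x)
      hr).arctan).const_mul 4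
    refine this.congr_fderiv ?_
    have e : 1 + (a * Real.cos (x 2) / x 1) ^ 2 = rho a x ^ 2 / x 1 ^ 2 := by
      rw [h.rho_sq]
      field_simp
    rw [e]
    ext v
    simp only [_root_.sub_apply, _root_.smul_apply, smul_eq_mul,
      coframe_one_apply, coframe_three_apply, dCoord, ContinuousLinearMap.proj_apply]
    field_simp
    ring
  rw [hf.fderiv, h.torsionMinus_kerr, hodgeStarOne, h.isOrthoFrame.sharp_eq]
  ext v
  have hv : ∀ X : Coord 4, Matrix.vecCons X v 0 = X ∧ Matrix.vecCons X v 1 = v 0 ∧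
      Matrix.vecCons X v 2 = v 1 ∧ Matrix.vecCons X v 3 = v 2 := fun X => ⟨rfl, rfl, rfl, rfl⟩
  simp only [Fin.sum_univ_four, lorentz, Matrix.cons_val, h.isOrthoFrame.dual, _root_.sub_apply,
    _root_.smul_apply, smul_eq_mul, Fin.reduceEq, if_true, if_false, volForm, e3, e2,
    ContinuousAlternatingMap.curryLeft_apply_apply, wedge_wedge_wedge_asForm_apply,
    wedge_wedge_asForm_apply, hv, ContinuousAlternatingMap.add_apply,
    ContinuousAlternatingMap.smul_apply, map_add, map_smul]
  ring

end Conclusions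

end KerrSen

theorem mainTheorem1 (a b : ℝ) (I : Set ℝ) (hI : IsOpen I) (Δ : ℝ → ℝ)
    (hΔ : DifferentiableOn ℝ Δ I) (hpos : ∀ r ∈ I, 0 < Δ r) :
    -- the metric, its orthonormal coframe, and the frame expression of `H`
    (KerrSen.IsMetricOn (KerrSen.region a b I) (KerrSen.metric a b Δ) ∧
      ∀ x ∈ KerrSen.region a b I,
        KerrSen.metric a b Δ x =
          -KerrSen.tensor (KerrSen.coframe a b Δ x 0) (KerrSen.coframe a b Δ x 0)
          + KerrSen.tensor (KerrSen.coframe a b Δ x 1) (KerrSen.coframe a b Δ x 1)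
          + KerrSen.tensor (KerrSen.coframe a b Δ x 2) (KerrSen.coframe a b Δ x 2)
          + KerrSen.tensor (KerrSen.coframe a b Δ x 3) (KerrSen.coframe a b Δ x 3) ∧
        KerrSen.fieldH a b Δ x =
          KerrSen.T0 1 a b x • KerrSen.e3 a b Δ 0 1 2 x
          + KerrSen.T1 1 a b Δ x • KerrSen.e3 a b Δ 0 2 3 x) ∧
    -- `h_+`, with torsion `T_+ = H`
    (KerrSen.IsGCCKY (KerrSen.region a b I) (KerrSen.metric a b Δ) (KerrSen.fieldH a b Δ)
        (KerrSen.hForm 1 a b Δ) ∧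
      ∀ x ∈ KerrSen.region a b I,
        (∀ X, KerrSen.covDeriv
            (KerrSen.torsionConn (KerrSen.metric a b Δ) (KerrSen.fieldH a b Δ))
            (KerrSen.hForm 1 a b Δ) x X =
          KerrSen.wedge (KerrSen.metric a b Δ x X) (KerrSen.asForm (KerrSen.xi 1 a b Δ x))) ∧
        KerrSen.asForm (KerrSen.xi 1 a b Δ x) =
          -(1 / 3 : ℝ) • KerrSen.codiff (KerrSen.metric a b Δ)
            (KerrSen.torsionConn (KerrSen.metric a b Δ) (KerrSen.fieldH a b Δ))
            (KerrSen.hForm 1 a b Δ) x ∧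
        KerrSen.sharp (KerrSen.metric a b Δ) x (KerrSen.xi 1 a b Δ x) =
          Real.exp (-KerrSen.dilaton a b x) • KerrSen.partialVec 0) ∧
    -- `h_-`, with torsion `T_-`
    (KerrSen.IsGCCKY (KerrSen.region a b I) (KerrSen.metric a b Δ) (KerrSen.torsionMinus a b Δ)
        (KerrSen.hForm (-1) a b Δ) ∧
      ∀ x ∈ KerrSen.region a b I,
        (∀ X, KerrSen.covDeriv
            (KerrSen.torsionConn (KerrSen.metric a b Δ) (KerrSen.torsionMinus a b Δ))
            (KerrSen.hForm (-1) a b Δ) x X =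
          KerrSen.wedge (KerrSen.metric a b Δ x X) (KerrSen.asForm (KerrSen.xi (-1) a b Δ x))) ∧
        KerrSen.asForm (KerrSen.xi (-1) a b Δ x) =
          -(1 / 3 : ℝ) • KerrSen.codiff (KerrSen.metric a b Δ)
            (KerrSen.torsionConn (KerrSen.metric a b Δ) (KerrSen.torsionMinus a b Δ))
            (KerrSen.hForm (-1) a b Δ) x ∧
        (a ≠ 0 → KerrSen.torsionMinus a b Δ x ≠ KerrSen.fieldH a b Δ x)) ∧
    -- `T_-` in the Kerr limit `b = 0`
    (DifferentiableOn ℝ (KerrSen.torsionMinus a 0 Δ) (KerrSen.region a 0 I) ∧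
      ∀ x ∈ KerrSen.region a 0 I,
        KerrSen.torsionMinus a 0 Δ x = (4 * a / KerrSen.rho a x ^ 3) •
          ((x 1 * Real.sin (x 2)) • KerrSen.e3 a 0 Δ 0 1 2 x
            + (Real.cos (x 2) * √(Δ (x 1))) • KerrSen.e3 a 0 Δ 0 2 3 x) ∧
        (a ≠ 0 → KerrSen.torsionMinus a 0 Δ x ≠ 0) ∧
        KerrSen.codiff (KerrSen.metric a 0 Δ) (KerrSen.leviCivita (KerrSen.metric a 0 Δ))
          (KerrSen.torsionMinus a 0 Δ) x = 0 ∧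
        (x 1 ≠ 0 → KerrSen.torsionMinus a 0 Δ x =
          KerrSen.hodgeStarOne (KerrSen.metric a 0 Δ) (KerrSen.volForm a 0 Δ) x
            (fderiv ℝ (fun y : KerrSen.Coord 4 =>
              4 * Real.arctan (a * Real.cos (y 2) / y 1)) x))) := by
  have hT : ∀ x ∈ KerrSen.region a b I, KerrSen.fieldH a b Δ x =
      KerrSen.T0 1 a b x • KerrSen.e3 a b Δ 0 1 2 x
        + KerrSen.T1 1 a b Δ x • KerrSen.e3 a b Δ 0 2 3 x := fun x hx =>
    (KerrSen.regular_of_mem_region hpos hx).fieldH_eq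
  obtain ⟨hp, hp'⟩ := KerrSen.hForm_isGCCKY hI hΔ hpos (one_mul 1) hT
  -- The same lemma serves both signs: `T_-` has the required frame expression by definition,
  -- whereas for `H` it had to be computed.
  obtain ⟨hm, hm'⟩ := KerrSen.hForm_isGCCKY (b := b) (s := -1) (a := a) hI hΔ hpos (by norm_num)
    (T := KerrSen.torsionMinus a b Δ) fun _ _ => rfl
  refine ⟨⟨KerrSen.isMetricOn_metric hI hΔ hpos, fun x hx =>
    ⟨(KerrSen.regular_of_mem_region hpos hx).metric_eq, hT x hx⟩⟩,
    ⟨hp, fun x hx => ⟨(hp' x hx).1, (hp' x hx).2,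
      (KerrSen.regular_of_mem_region hpos hx).sharp_xi⟩⟩,
    ⟨hm, fun x hx => ⟨(hm' x hx).1, (hm' x hx).2,
      (KerrSen.regular_of_mem_region hpos hx).torsionMinus_ne⟩⟩,
    KerrSen.differentiableOn_torsionMinus_kerr hI hΔ hpos, fun x hx => ?_⟩
  have h := KerrSen.regular_of_mem_region hpos hx
  exact ⟨h.torsionMinus_kerr, h.torsionMinus_kerr_ne_zero,
    KerrSen.codiff_torsionMinus_kerr hI hΔ hpos hx, h.torsionMinus_kerr_eq_hodgeStar⟩
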